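/- Let $d\ge 1$, let $B_1\subset\mathbb R^d$ be the open unit ball, let $S(d)$ be the space of symmetric $d\times d$ real matrices with a norm $\|\cdot\|$ (the Frobenius norm, say), and let $\Lambda>0$ and $p>d/2$ with $p>1$ (the latter is automatic if $d\ge 2$). Let $F:S(d)\to\mathbb R$ be convex with $F(0)=0$, and suppose that there is $\lambda\ge 1$ such that $$\tfrac1\lambda\|M\|\le F(M)\le\lambda\|M\|\qquad\text{for every } M\in S(d).$$ Let $g\in W^{2,p}_{loc}(B_1)$ be non-negative and not identically zero (in the almost-everywhere sense). Write $W^{2,p}_{loc}(B_1)\cap W^{1,p}_g(B_1)$ for the set of all $u\in W^{2,p}_{loc}(B_1)$ with $u-g\in W^{1,p}_0(B_1)$, and for such $u$ put $$\mathcal F_{\Lambda,p}[u]:=\int_{B_1}F(D^2u)^p\,dx+\Lambda\,|\{u>0\}\cap B_1|\in[0,\infty],$$ where $D^2u$ is the weak Hessian. Then there exists $u^*\in W^{2,p}_{loc}(B_1)\cap W^{1,p}_g(B_1)$ such that $$\mathcal F_{\Lambda,p}[u^*]\le\mathcal F_{\Lambda,p}[u]\qquad\text{for all } u\in W^{2,p}_{loc}(B_1)\cap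 W^{1,p}_g(B_1).$$ -/

import Mathlib

open MeasureTheory
open scoped ENNReal Distributions Matrix.Norms.Frobenius

/-- The real vector space `S(d)` of symmetric `d × d` matrices, normed by the Frobenius norm. -/
def SymMat (d : ℕ) : Submodule ℝ (Matrix (Fin d) (Fin d) ℝ) where
  carrier := {M | M.IsSymm}
  add_mem' hA hB := Matrix.IsSymm.add hA hB
  zero_mem' := Matrix.isSymm_zero
  smul_mem' c _ hA := Matrix.IsSymm.smul hA c

/-- The growth condition on `F : S(d) → ℝ` with constant `lam`. -/
def GrowthCondition {d : ℕ} (F : SymMat d → ℝ) (lam : ℝ) : Prop :=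
  1 ≤ lam ∧ (∀ M : SymMat d, 1 / lam * ‖M‖ ≤ F M ∧ F M ≤ lam * ‖M‖) ∧ F 0 = 0

/-- The open unit ball `B_1` of `ℝ^d`. -/
def unitBall (d : ℕ) : TopologicalSpace.Opens (EuclideanSpace ℝ (Fin d)) :=
  ⟨Metric.ball 0 1, Metric.isOpen_ball⟩

/-- The classical partial derivative `∂_i f`. -/
noncomputable def partialDeriv {d : ℕ} (i : Fin d) (f : EuclideanSpace ℝ (Fin d) → ℝ)
    (x : EuclideanSpace ℝ (Fin d)) : ℝ :=
  fderiv ℝ f x (EuclideanSpace.single i 1)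

/-- `f ∈ L^p_loc(Ω)`. -/
def MemLpLoc {d : ℕ} (Ω : TopologicalSpace.Opens (EuclideanSpace ℝ (Fin d))) (p : ℝ≥0∞)
    (f : EuclideanSpace ℝ (Fin d) → ℝ) : Prop :=
  ∀ K : Set (EuclideanSpace ℝ (Fin d)), IsCompact K → K ⊆ Ω → MemLp f p (volume.restrict K)

/-- `G` is a weak gradient of `u` in `Ω`: `∫_Ω u ∂_i φ = - ∫_Ω G_i φ` for all `φ ∈ C_c^∞(Ω)`. -/
def HasWeakGradient {d : ℕ} (Ω : TopologicalSpace.Opens (EuclideanSpace ℝ (Fin d)))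
    (u : EuclideanSpace ℝ (Fin d) → ℝ)
    (G : EuclideanSpace ℝ (Fin d) → EuclideanSpace ℝ (Fin d)) : Prop :=
  LocallyIntegrableOn u Ω ∧ (∀ i, LocallyIntegrableOn (fun x => G x i) Ω) ∧
    ∀ (φ : 𝓓(Ω, ℝ)) (i : Fin d),
      ∫ x in Ω, u x * partialDeriv i φ x = - ∫ x in Ω, G x i * φ x

/-- `H` is a weak Hessian of `u` in `Ω`: `∫_Ω u ∂_i ∂_j φ = ∫_Ω H_ij φ` for all
`φ ∈ C_c^∞(Ω)`. -/
def HasWeakHessian {d : ℕ} (Ω : TopologicalSpace.Opens (EuclideanSpace ℝ (Fin d)))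
    (u : EuclideanSpace ℝ (Fin d) → ℝ) (H : EuclideanSpace ℝ (Fin d) → SymMat d) : Prop :=
  LocallyIntegrableOn u Ω ∧ (∀ i j, LocallyIntegrableOn (fun x => (H x).1 i j) Ω) ∧
    ∀ (φ : 𝓓(Ω, ℝ)) (i j : Fin d),
      ∫ x in Ω, u x * partialDeriv i (partialDeriv j φ) x = ∫ x in Ω, (H x).1 i j * φ x

/-- `u ∈ W^{2,p}_loc(Ω)`: `u` and its weak derivatives of orders one and two are in
`L^p_loc(Ω)`. -/
def MemW2pLoc {d : ℕ} (Ω : TopologicalSpace.Opens (EuclideanSpace ℝ (Fin d))) (p : ℝ≥0∞)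
    (u : EuclideanSpace ℝ (Fin d) → ℝ) : Prop :=
  MemLpLoc Ω p u ∧
    (∃ G, HasWeakGradient Ω u G ∧ ∀ i, MemLpLoc Ω p (fun x => G x i)) ∧
    ∃ H, HasWeakHessian Ω u H ∧ ∀ i j, MemLpLoc Ω p (fun x => (H x).1 i j)

/-- `u ∈ W^{1,p}_0(Ω)`: `u ∈ W^{1,p}(Ω)` lies in the closure of `C_c^∞(Ω)` for the
`W^{1,p}(Ω)` norm. -/
def MemW1pZero {d : ℕ} (Ω : TopologicalSpace.Opens (EuclideanSpace ℝ (Fin d))) (p : ℝ≥0∞)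
    (u : EuclideanSpace ℝ (Fin d) → ℝ) : Prop :=
  MemLp u p (volume.restrict Ω) ∧
    ∃ G, HasWeakGradient Ω u G ∧ (∀ i, MemLp (fun x => G x i) p (volume.restrict Ω)) ∧
      ∀ ε : ℝ, 0 < ε → ∃ φ : 𝓓(Ω, ℝ),
        eLpNorm (fun x => u x - φ x) p (volume.restrict Ω) < ENNReal.ofReal ε ∧
        ∀ i, eLpNorm (fun x => G x i - partialDeriv i φ x) p (volume.restrict Ω)
          < ENNReal.ofReal ε

/-- `u ∈ W^{2,p}_loc(Ω) ∩ W^{1,p}_g(Ω)`: `u ∈ W^{2,p}_loc(Ω)` and `u - g ∈ W^{1,p}_0(Ω)`. -/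
def MemAffineSobolev {d : ℕ} (Ω : TopologicalSpace.Opens (EuclideanSpace ℝ (Fin d))) (p : ℝ≥0∞)
    (g u : EuclideanSpace ℝ (Fin d) → ℝ) : Prop :=
  MemW2pLoc Ω p u ∧ MemW1pZero Ω p (fun x => u x - g x)

open Classical in
/-- The weak Hessian `D²u` in `Ω` (determined up to a null set of `Ω` when it exists; zero by
convention when it does not). -/
noncomputable def weakHessian {d : ℕ} (Ω : TopologicalSpace.Opens (EuclideanSpace ℝ (Fin d)))
    (u : EuclideanSpace ℝ (Fin d) → ℝ) : EuclideanSpace ℝ (Fin d) → SymMat d :=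
  if h : ∃ H, HasWeakHessian Ω u H then h.choose else 0

/-- The functional `∫_{B_1} F(D²u)^p dx + Λ |{u > 0} ∩ B_1|`, with values in `[0, ∞]`; it is
used for non-negative `F` only. -/
noncomputable def hessianFunctional {d : ℕ} (F : SymMat d → ℝ) (Λ p : ℝ)
    (u : EuclideanSpace ℝ (Fin d) → ℝ) : ℝ≥0∞ :=
  (∫⁻ x in unitBall d, ENNReal.ofReal (F (weakHessian (unitBall d) u x) ^ p)) +
    ENNReal.ofReal Λ * volume ({x | 0 < u x} ∩ (unitBall d : Set (EuclideanSpace ℝ (Fin d))))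

/-!
The minimizer is obtained by the direct method. If some admissible `u₀` has finite value, let `uₙ`
be a minimizing sequence. The growth of `F` bounds the weak Hessians of `wₙ = uₙ - u₀` in
`L^p(B₁)`, and `wₙ` has zero boundary values.

*A priori bound.* The functions `∂ᵢwₙ` have mean zero on almost every chord of the ball in the
direction `eᵢ`, because they are limits of derivatives of test functions, and they oscillate along
a chord by at most the integral of `|∂ᵢᵢwₙ|` over it. Hence `|∂ᵢwₙ|` is bounded pointwise by this
line integral (`ae_enorm_le_lintegral_line_of_weak_deriv`), which gives
`‖∂ᵢwₙ‖_p ≤ 4 ‖∂ᵢᵢwₙ‖_p` (`IsTestLimit.eLpNorm_gradient_le`) and, in the same way, Poincaré's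
inequality (`IsTestLimit.eLpNorm_le`). So the jets `(wₙ, ∇wₙ, D²wₙ)` are bounded in `L^p`.

*Compactness.* By Rellich's theorem in `L¹` (`exists_subseq_tendsto_eLpNorm_one`) a subsequence of
`wₙ` converges in `L¹` and, along a further subsequence, almost everywhere. The space `L^p` is
uniformly convex, so the closed convex hulls of the tails of the sequence of jets have a common
point `j` (`exists_forall_mem_closure_convexHull_tail`). Every closed convex set of jets that
contains a tail of the sequence contains `j`. Applied to the set of jets of functions with zero
boundary values, to small `L¹`-balls around the limit of `wₙ`, and to the sublevel sets of the
convex energy `∫ F(D²u₀ + D²w)^p`, this identifies the value component of `j` with the limit `w` of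
`wₙ`, shows that `u₀ + w` is admissible, and yields lower semicontinuity of the energy
(`exists_subseq_tendsto_zeroBoundaryJet`).

The measure of the positivity set is lower semicontinuous under almost everywhere convergence
(`measure_pos_le_liminf`), so `u₀ + w` is a minimizer.
-/

open Filter Topology
open scoped ContDiff

/-! ### Uniform convexity of `L^p` and bounded sequences -/

theorem norm_half_smul_add_rpow_lt {E : Type*} [NormedAddCommGroup E] [NormedSpace ℝ E]
    [StrictConvexSpace ℝ E] {p : ℝ} (hp : 1 < p) {x y : E} (hxy : x ≠ y) :
    ‖(1 / 2 : ℝ) • (x + y)‖ ^ p < 1 / 2 * ‖x‖ ^ p + 1 / 2 * ‖y‖ ^ p := by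
  have hp0 : 0 < p := by linarith
  by_cases h : ‖x‖ = ‖y‖
  · have h1 : ‖(1 / 2 : ℝ) • (x + y)‖ < ‖x‖ := (norm_midpoint_lt_iff h).2 hxy
    have h2 := Real.rpow_lt_rpow (norm_nonneg _) h1 hp0
    rw [← h]
    linarith
  · have h1 : ‖(1 / 2 : ℝ) • (x + y)‖ ≤ 1 / 2 * ‖x‖ + 1 / 2 * ‖y‖ := by
      rw [norm_smul, Real.norm_of_nonneg (by norm_num)]
      linarith [norm_add_le x y]
    have h2 := (strictConvexOn_rpow hp).2 (norm_nonneg x) (norm_nonneg y) h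
      (by norm_num : (0 : ℝ) < 1 / 2) (by norm_num : (0 : ℝ) < 1 / 2) (by norm_num)
    simp only [smul_eq_mul] at h2
    exact (Real.rpow_le_rpow (norm_nonneg _) h1 hp0.le).trans_lt h2

/-- A quantitative form of the strict convexity of `‖·‖ ^ p`: up to an arbitrarily small multiple
of `‖x‖ ^ p + ‖y‖ ^ p`, the convexity gap at the midpoint controls `‖x - y‖ ^ p`. By homogeneity
this is a statement on the compact set `‖x‖ ^ p + ‖y‖ ^ p = 1`, where the gap is bounded below as
long as `x` and `y` stay apart. Unlike strict convexity, the inequality can be integrated. -/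
theorem exists_norm_sub_rpow_le {E : Type*} [NormedAddCommGroup E] [NormedSpace ℝ E]
    [StrictConvexSpace ℝ E] [FiniteDimensional ℝ E] {p : ℝ} (hp : 1 < p) {ε : ℝ} (hε : 0 < ε) :
    ∃ K : ℝ, 0 ≤ K ∧ ∀ x y : E, ‖x - y‖ ^ p ≤ ε * (‖x‖ ^ p + ‖y‖ ^ p) +
      K * (1 / 2 * ‖x‖ ^ p + 1 / 2 * ‖y‖ ^ p - ‖(1 / 2 : ℝ) • (x + y)‖ ^ p) := by
  have hp0 : 0 < p := by linarith
  have : ProperSpace E := FiniteDimensional.proper_real E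
  let gap : E × E → ℝ := fun z =>
    1 / 2 * ‖z.1‖ ^ p + 1 / 2 * ‖z.2‖ ^ p - ‖(1 / 2 : ℝ) • (z.1 + z.2)‖ ^ p
  have hpc : Continuous fun t : ℝ => t ^ p := Real.continuous_rpow_const hp0.le
  have hgap : Continuous gap := by
    have h1 : Continuous fun z : E × E => ‖z.1‖ ^ p := hpc.comp (by fun_prop)
    have h2 : Continuous fun z : E × E => ‖z.2‖ ^ p := hpc.comp (by fun_prop)
    have h3 : Continuous fun z : E × E => ‖(1 / 2 : ℝ) • (z.1 + z.2)‖ ^ p :=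
      hpc.comp (by fun_prop)
    fun_prop
  have hgap0 : ∀ z, 0 ≤ gap z := by
    intro z
    by_cases hz : z.1 = z.2
    · have : (1 / 2 : ℝ) • (z.2 + z.2) = z.2 := by rw [← two_smul ℝ z.2, smul_smul]; norm_num
      simp only [gap, hz, this]; linarith
    · have := norm_half_smul_add_rpow_lt hp hz
      simp only [gap]; linarith
  let S : Set (E × E) := {z | ‖z.1‖ ^ p + ‖z.2‖ ^ p = 1 ∧ ε ≤ ‖z.1 - z.2‖ ^ p}
  have hSle : ∀ z : E × E, ‖z.1‖ ^ p + ‖z.2‖ ^ p = 1 → ‖z.1‖ ≤ 1 ∧ ‖z.2‖ ≤ 1 := by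
    intro z hz
    have h1 := Real.rpow_nonneg (norm_nonneg z.1) p
    have h2 := Real.rpow_nonneg (norm_nonneg z.2) p
    constructor
    · by_contra! h
      have := Real.one_lt_rpow h hp0
      linarith
    · by_contra! h
      have := Real.one_lt_rpow h hp0
      linarith
  have hSc : IsCompact S := by
    refine Metric.isCompact_of_isClosed_isBounded ?_ ?_
    · have h1 : Continuous fun z : E × E => ‖z.1‖ ^ p := hpc.comp (by fun_prop)
      have h2 : Continuous fun z : E × E => ‖z.2‖ ^ p := hpc.comp (by fun_prop)
      have h3 : Continuous fun z : E × E => ‖z.1 - z.2‖ ^ p := hpc.comp (by fun_prop)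
      exact (isClosed_eq (h1.add h2) continuous_const).inter (isClosed_le continuous_const h3)
    · refine (Metric.isBounded_closedBall (x := (0 : E × E)) (r := 1)).subset ?_
      intro z hz
      rw [mem_closedBall_zero_iff, Prod.norm_def]
      exact max_le (hSle z hz.1).1 (hSle z hz.1).2
  obtain ⟨m, hm0, hm⟩ : ∃ m > 0, ∀ z ∈ S, m ≤ gap z := by
    rcases S.eq_empty_or_nonempty with h | h
    · exact ⟨1, one_pos, by simp [h]⟩
    · obtain ⟨z, hz, hmin⟩ := hSc.exists_isMinOn h hgap.continuousOn
      refine ⟨gap z, ?_, fun w hw => hmin hw⟩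
      have hne : z.1 ≠ z.2 := by
        intro h
        have := hz.2
        rw [h, sub_self, norm_zero, Real.zero_rpow hp0.ne'] at this
        linarith
      have := norm_half_smul_add_rpow_lt hp hne
      simp only [gap]; linarith
  have hK : 0 ≤ 2 ^ p / m := by positivity
  refine ⟨2 ^ p / m, hK, fun x y => ?_⟩
  have key : ∀ z : E × E, ‖z.1‖ ^ p + ‖z.2‖ ^ p = 1 →
      ‖z.1 - z.2‖ ^ p ≤ ε + 2 ^ p / m * gap z := by
    intro z hz
    by_cases hzS : ε ≤ ‖z.1 - z.2‖ ^ p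
    · have h1 : ‖z.1 - z.2‖ ^ p ≤ 2 ^ p := by
        refine Real.rpow_le_rpow (norm_nonneg _) ?_ hp0.le
        have := hSle z hz
        linarith [norm_sub_le z.1 z.2]
      have h2 : (2 : ℝ) ^ p ≤ 2 ^ p / m * gap z := by
        have := mul_le_mul_of_nonneg_left (hm z ⟨hz, hzS⟩) hK
        rwa [div_mul_cancel₀ _ hm0.ne'] at this
      linarith
    · have := mul_nonneg hK (hgap0 z)
      linarith
  set T := ‖x‖ ^ p + ‖y‖ ^ p with hT
  have hx0 := Real.rpow_nonneg (norm_nonneg x) p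
  have hy0 := Real.rpow_nonneg (norm_nonneg y) p
  rcases (add_nonneg hx0 hy0).eq_or_lt with h0 | h0
  · have hx : x = 0 := by
      rw [← norm_eq_zero, ← Real.rpow_eq_zero (norm_nonneg x) hp0.ne']; linarith
    have hy : y = 0 := by
      rw [← norm_eq_zero, ← Real.rpow_eq_zero (norm_nonneg y) hp0.ne']; linarith
    simp [hT, hx, hy, Real.zero_rpow hp0.ne']
  · rw [← hT] at h0
    set r := T ^ (1 / p) with hr
    have hr0 : 0 < r := Real.rpow_pos_of_pos h0 _
    have hrp : r ^ p = T := by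
      rw [hr, ← Real.rpow_mul h0.le, one_div_mul_cancel hp0.ne', Real.rpow_one]
    have hscale : ∀ v : E, ‖r⁻¹ • v‖ ^ p = T⁻¹ * ‖v‖ ^ p := by
      intro v
      rw [norm_smul, Real.norm_of_nonneg (inv_nonneg.2 hr0.le),
        Real.mul_rpow (inv_nonneg.2 hr0.le) (norm_nonneg _), Real.inv_rpow hr0.le, hrp]
    have h1 := key (r⁻¹ • x, r⁻¹ • y) (by
      simp only [hscale]; rw [← mul_add, ← hT, inv_mul_cancel₀ h0.ne'])
    have e1 : (1 / 2 : ℝ) • (r⁻¹ • x + r⁻¹ • y) = r⁻¹ • ((1 / 2 : ℝ) • (x + y)) := by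
      rw [← smul_add, smul_comm]
    simp only [gap] at h1
    rw [← smul_sub, e1] at h1
    simp only [hscale] at h1
    have h2 := mul_le_mul_of_nonneg_left h1 h0.le
    have e2 : ∀ a : ℝ, T * (T⁻¹ * a) = a := fun a => by
      rw [← mul_assoc, mul_inv_cancel₀ h0.ne', one_mul]
    rw [e2] at h2
    calc ‖x - y‖ ^ p ≤ _ := h2
      _ = ε * T + 2 ^ p / m * (1 / 2 * (T * (T⁻¹ * ‖x‖ ^ p)) + 1 / 2 * (T * (T⁻¹ * ‖y‖ ^ p))
          - T * (T⁻¹ * ‖(1 / 2 : ℝ) • (x + y)‖ ^ p)) := by ring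
      _ = _ := by simp only [e2]

theorem MeasureTheory.Lp.norm_rpow_eq_integral {α E : Type*} [MeasurableSpace α] {μ : Measure α}
    [NormedAddCommGroup E] {p : ℝ} (hp : 0 < p) (f : Lp E (ENNReal.ofReal p) μ) :
    ‖f‖ ^ p = ∫ x, ‖f x‖ ^ p ∂μ := by
  have h := (Lp.memLp f).eLpNorm_eq_integral_rpow_norm (by simpa using hp) (by simp)
  rw [ENNReal.toReal_ofReal hp.le] at h
  have h0 : 0 ≤ ∫ x, ‖f x‖ ^ p ∂μ :=
    integral_nonneg fun x => Real.rpow_nonneg (norm_nonneg _) _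
  rw [Lp.norm_def, h, ENNReal.toReal_ofReal (by positivity), ← Real.rpow_mul h0,
    inv_mul_cancel₀ hp.ne', Real.rpow_one]

theorem MeasureTheory.Lp.exists_norm_sub_rpow_le {α E : Type*} [MeasurableSpace α] {μ : Measure α}
    [NormedAddCommGroup E] [NormedSpace ℝ E]
    [StrictConvexSpace ℝ E] [FiniteDimensional ℝ E] {p : ℝ} (hp : 1 < p) {ε : ℝ} (hε : 0 < ε) :
    ∃ K : ℝ, 0 ≤ K ∧ ∀ f g : Lp E (ENNReal.ofReal p) μ,
      ‖f - g‖ ^ p ≤ ε * (‖f‖ ^ p + ‖g‖ ^ p) +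
        K * (1 / 2 * ‖f‖ ^ p + 1 / 2 * ‖g‖ ^ p - ‖(1 / 2 : ℝ) • (f + g)‖ ^ p) := by
  have hp0 : 0 < p := by linarith
  obtain ⟨K, hK, h⟩ := _root_.exists_norm_sub_rpow_le (E := E) hp hε
  refine ⟨K, hK, fun f g => ?_⟩
  have hint : ∀ u : Lp E (ENNReal.ofReal p) μ, Integrable (fun x => ‖u x‖ ^ p) μ := by
    intro u
    have := (Lp.memLp u).integrable_norm_rpow (by simpa using hp0) (by simp)
    rwa [ENNReal.toReal_ofReal hp0.le] at this
  simp only [Lp.norm_rpow_eq_integral hp0]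
  have e1 : ∫ x, ‖(f - g : Lp E (ENNReal.ofReal p) μ) x‖ ^ p ∂μ ≤
      ∫ x, (ε * (‖f x‖ ^ p + ‖g x‖ ^ p) + K * (1 / 2 * ‖f x‖ ^ p + 1 / 2 * ‖g x‖ ^ p
        - ‖((1 / 2 : ℝ) • (f + g) : Lp E (ENNReal.ofReal p) μ) x‖ ^ p)) ∂μ := by
    refine integral_mono_ae (hint _) ?_ ?_
    · have := hint f
      have := hint g
      have := hint ((1 / 2 : ℝ) • (f + g))
      fun_prop
    · filter_upwards [Lp.coeFn_sub f g, Lp.coeFn_smul (1 / 2 : ℝ) (f + g), Lp.coeFn_add f g]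
        with x h1 h2 h3
      rw [h1, h2]
      simp only [Pi.smul_apply, Pi.sub_apply, h3, Pi.add_apply]
      exact h _ _
  refine e1.trans_eq ?_
  have i1 := hint f
  have i2 := hint g
  have i3 := hint ((1 / 2 : ℝ) • (f + g))
  rw [integral_add (by fun_prop) (by fun_prop), integral_const_mul, integral_const_mul,
    integral_add i1 i2, integral_sub (by fun_prop) i3, integral_add (by fun_prop) (by fun_prop),
    integral_const_mul, integral_const_mul]

/-- In a space with a uniformly convex `p`-th power of the norm, the closed convex hulls of the
tails of a bounded sequence have a common point. This replaces reflexivity and Mazur's lemma: the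
point is the limit of almost minimizers of the norm over the tails, which form a Cauchy
sequence. -/
theorem exists_forall_mem_closure_convexHull_tail {X : Type*} [NormedAddCommGroup X]
    [NormedSpace ℝ X] [CompleteSpace X] {p : ℝ} (hp : 0 < p)
    (huc : ∀ ε : ℝ, 0 < ε → ∃ K : ℝ, 0 ≤ K ∧ ∀ f g : X, ‖f - g‖ ^ p ≤ ε * (‖f‖ ^ p + ‖g‖ ^ p) +
        K * (1 / 2 * ‖f‖ ^ p + 1 / 2 * ‖g‖ ^ p - ‖(1 / 2 : ℝ) • (f + g)‖ ^ p))
    (f : ℕ → X) {C : ℝ} (hC : ∀ n, ‖f n‖ ≤ C) :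
    ∃ j : X, ∀ n, j ∈ closure (convexHull ℝ (f '' Set.Ici n)) := by
  let A : ℕ → Set X := fun n => convexHull ℝ (f '' Set.Ici n)
  have hAanti : ∀ {m n}, m ≤ n → A n ⊆ A m := fun h =>
    convexHull_mono (Set.image_mono (Set.Ici_subset_Ici.2 h))
  have hmem : ∀ n, f n ∈ A n := fun n => subset_convexHull ℝ _ ⟨n, le_refl n, rfl⟩
  let V : ℕ → Set ℝ := fun n => (fun x : X => ‖x‖ ^ p) '' A n
  have hVne : ∀ n, (V n).Nonempty := fun n => ⟨_, f n, hmem n, rfl⟩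
  have hVbdd : ∀ n, BddBelow (V n) := fun n => ⟨0, by
    rintro _ ⟨x, -, rfl⟩; exact Real.rpow_nonneg (norm_nonneg _) _⟩
  let m : ℕ → ℝ := fun n => sInf (V n)
  have hmle : ∀ n, ∀ x ∈ A n, m n ≤ ‖x‖ ^ p := fun n x hx => csInf_le (hVbdd n) ⟨x, hx, rfl⟩
  have hmmono : Monotone m := fun a b hab =>
    csInf_le_csInf (hVbdd a) (hVne b) (Set.image_mono (hAanti hab))
  have hm0 : ∀ n, 0 ≤ m n := fun n => le_csInf (hVne n) (by
    rintro _ ⟨x, -, rfl⟩; exact Real.rpow_nonneg (norm_nonneg _) _)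
  have hC0 : 0 ≤ C := (norm_nonneg _).trans (hC 0)
  have hmC : ∀ n, m n ≤ C ^ p := fun n => (hmle n _ (hmem n)).trans
    (Real.rpow_le_rpow (norm_nonneg _) (hC n) hp.le)
  obtain ⟨M, hM⟩ : ∃ M, Tendsto m atTop (𝓝 M) :=
    ⟨_, tendsto_atTop_ciSup hmmono ⟨C ^ p, by rintro _ ⟨n, rfl⟩; exact hmC n⟩⟩
  have hmM : ∀ n, m n ≤ M := fun n => hmmono.ge_of_tendsto hM n
  have hex : ∀ n : ℕ, ∃ x ∈ A n, ‖x‖ ^ p < m n + 1 / ((n : ℝ) + 1) := by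
    intro n
    obtain ⟨_, ⟨x, hx, rfl⟩, hlt⟩ := exists_lt_of_csInf_lt (hVne n)
      (lt_add_of_pos_right (m n) (Nat.one_div_pos_of_nat (n := n)))
    exact ⟨x, hx, hlt⟩
  choose h hhA hhlt using hex
  have hcauchy : CauchySeq h := by
    rw [Metric.cauchySeq_iff']
    intro ε hε
    have hM0 : 0 ≤ M := (hm0 0).trans (hmM 0)
    have hεp : 0 < ε ^ p := Real.rpow_pos_of_pos hε p
    obtain ⟨K, hK, hKineq⟩ := huc (ε ^ p / (4 * (M + 1)))
      (by positivity)
    -- past `N`, both the defect of minimality and the variation of the infima are negligible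
    have hlim : Tendsto (fun n => K * (M - m n + 1 / ((n : ℝ) + 1))) atTop (𝓝 0) := by
      have := ((tendsto_const_nhds (x := M)).sub hM).add tendsto_one_div_add_atTop_nhds_zero_nat
      simpa using this.const_mul K
    obtain ⟨N, hN⟩ := (hlim.eventually (gt_mem_nhds (half_pos hεp))).exists
    refine ⟨N, fun n hn => ?_⟩
    have hbd : ∀ k, N ≤ k → ‖h k‖ ^ p ≤ M + 1 / ((N : ℝ) + 1) := by
      intro k hk
      have h1 := (hhlt k).le
      have h2 : 1 / ((k : ℝ) + 1) ≤ 1 / ((N : ℝ) + 1) := Nat.one_div_le_one_div hk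
      linarith [hmM k]
    have h1 : 1 / ((N : ℝ) + 1) ≤ 1 := by
      rw [div_le_one (by positivity)]; linarith [Nat.cast_nonneg (α := ℝ) N]
    have hmid : m N ≤ ‖(1 / 2 : ℝ) • (h n + h N)‖ ^ p := by
      refine hmle N _ ?_
      rw [smul_add]
      exact convex_convexHull ℝ _ (hAanti hn (hhA n)) (hhA N) (by norm_num) (by norm_num)
        (by norm_num)
    have h2 := hKineq (h n) (h N)
    have b1 := hbd n hn
    have b2 := hbd N le_rfl
    have h3 : ε ^ p / (4 * (M + 1)) * (‖h n‖ ^ p + ‖h N‖ ^ p) ≤ ε ^ p / 2 := by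
      have : ‖h n‖ ^ p + ‖h N‖ ^ p ≤ 2 * (M + 1) := by linarith
      calc _ ≤ ε ^ p / (4 * (M + 1)) * (2 * (M + 1)) := by gcongr
        _ = ε ^ p / 2 := by field_simp; norm_num
    have h4 : K * (1 / 2 * ‖h n‖ ^ p + 1 / 2 * ‖h N‖ ^ p - ‖(1 / 2 : ℝ) • (h n + h N)‖ ^ p)
        ≤ K * (M - m N + 1 / ((N : ℝ) + 1)) := by
      gcongr
      linarith
    have h5 : ‖h n - h N‖ ^ p < ε ^ p := by linarith
    rw [dist_eq_norm]
    exact (Real.rpow_lt_rpow_iff (norm_nonneg _) hε.le hp).1 h5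
  obtain ⟨j, hj⟩ := cauchySeq_tendsto_of_complete hcauchy
  refine ⟨j, fun n => mem_closure_of_tendsto hj ?_⟩
  filter_upwards [eventually_ge_atTop n] with k hk using hAanti hk (hhA k)

/-! ### Compactness in `L¹` of bounded gradient sequences -/

theorem exists_subseq_tendsto_apply {X : Type*} [NormedAddCommGroup X] [NormedSpace ℝ X]
    [TopologicalSpace.SeparableSpace X] (ℓ : ℕ → StrongDual ℝ X) {C : ℝ} (hC : ∀ n, ‖ℓ n‖ ≤ C) :
    ∃ σ : ℕ → ℕ, StrictMono σ ∧ ∀ x : X, ∃ l : ℝ, Tendsto (fun n => ℓ (σ n) x) atTop (𝓝 l) := by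
  have hball : ∀ n, StrongDual.toWeakDual (ℓ n) ∈
      WeakDual.toStrongDual ⁻¹' Metric.closedBall (0 : StrongDual ℝ X) C := by
    intro n
    change ℓ n ∈ Metric.closedBall (0 : StrongDual ℝ X) C
    rw [mem_closedBall_zero_iff]
    exact hC n
  obtain ⟨L, -, σ, hσ, hL⟩ := WeakDual.isSeqCompact_closedBall ℝ X 0 C hball
  exact ⟨σ, hσ, fun x => ⟨L x, ((WeakDual.eval_continuous x).tendsto L).comp hL⟩⟩

/-- Weak-* sequential compactness: a sequence bounded in `L¹` and carried by a compact set has a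
subsequence whose integrals against every continuous function converge. -/
theorem exists_subseq_tendsto_integral_mul {E : Type*} [NormedAddCommGroup E] [NormedSpace ℝ E]
    [FiniteDimensional ℝ E] [MeasurableSpace E] [BorelSpace E] {μ : Measure E}
    {K : Set E} (hK : IsCompact K) {f : ℕ → E → ℝ} (hf : ∀ n, Integrable (f n) μ)
    (hfK : ∀ n, ∀ x, x ∉ K → f n x = 0) {C : ℝ} (hC : ∀ n, ∫ x, ‖f n x‖ ∂μ ≤ C) :
    ∃ σ : ℕ → ℕ, StrictMono σ ∧ ∀ g : E → ℝ, Continuous g →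
      ∃ l : ℝ, Tendsto (fun n => ∫ x, f (σ n) x * g x ∂μ) atTop (𝓝 l) := by
  have : CompactSpace K := isCompact_iff_compactSpace.1 hK
  have : ProperSpace E := FiniteDimensional.proper_real E
  have hmK : MeasurableSet K := hK.measurableSet
  let ν : Measure K := μ.comap (↑)
  have hi : ∀ n, Integrable (fun x : K => f n x) ν := fun n => by
    have h := (hf n).integrableOn (s := K)
    rw [IntegrableOn, ← map_comap_subtype_coe hmK,
      (MeasurableEmbedding.subtype_coe hmK).integrable_map_iff] at h
    exact h
  have hig : ∀ n (g : C(K, ℝ)), Integrable (fun x : K => f n x * g x) ν := fun n g =>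
    (hi n).mul_bdd (c := ‖g‖) g.continuous.aestronglyMeasurable
      (Eventually.of_forall fun x => g.norm_coe_le_norm x)
  have hset : ∀ F : E → ℝ, (∀ x, x ∉ K → F x = 0) → ∫ x : K, F x ∂ν = ∫ x, F x ∂μ := by
    intro F hF
    rw [integral_subtype_comap hmK F]
    exact setIntegral_eq_integral_of_forall_compl_eq_zero hF
  let ℓ : ℕ → (C(K, ℝ) →L[ℝ] ℝ) := fun n =>
    LinearMap.mkContinuous
      { toFun := fun g => ∫ x : K, f n x * g x ∂ν
        map_add' := fun g h => by
          rw [← integral_add (hig n g) (hig n h)]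
          simp only [ContinuousMap.add_apply, mul_add]
        map_smul' := fun c g => by
          simp only [ContinuousMap.smul_apply, smul_eq_mul, RingHom.id_apply]
          rw [← integral_const_mul]
          congr 1; ext x; ring } C (by
      intro g
      simp only [LinearMap.coe_mk, AddHom.coe_mk]
      calc ‖∫ x : K, f n x * g x ∂ν‖ ≤ ∫ x : K, ‖f n x * g x‖ ∂ν := norm_integral_le_integral_norm _
        _ ≤ ∫ x : K, ‖f n x‖ * ‖g‖ ∂ν := by
            refine integral_mono (hig n g).norm ((hi n).norm.mul_const _) fun x => ?_
            simp only [norm_mul]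
            exact mul_le_mul_of_nonneg_left (g.norm_coe_le_norm x) (norm_nonneg _)
        _ = (∫ x, ‖f n x‖ ∂μ) * ‖g‖ := by
            rw [integral_mul_const, hset (fun x => ‖f n x‖)]
            intro x hx
            simp [hfK n x hx]
        _ ≤ C * ‖g‖ := mul_le_mul_of_nonneg_right (hC n) (norm_nonneg _))
  have hC0 : 0 ≤ C := (integral_nonneg fun x => norm_nonneg _).trans (hC 0)
  obtain ⟨σ, hσ, hL⟩ := exists_subseq_tendsto_apply ℓ
    fun n => LinearMap.mkContinuous_norm_le _ hC0 _
  refine ⟨σ, hσ, fun g hg => ?_⟩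
  let g' : C(K, ℝ) := ⟨fun x => g x, by fun_prop⟩
  obtain ⟨l, hl⟩ := hL g'
  refine ⟨l, hl.congr fun n => ?_⟩
  change ∫ x : K, f (σ n) x * g x ∂ν = _
  rw [hset (fun x => f (σ n) x * g x)]
  intro x hx
  simp [hfK _ x hx]

theorem lintegral_enorm_sub_translate_le {E : Type*} [NormedAddCommGroup E] [NormedSpace ℝ E]
    [FiniteDimensional ℝ E] [MeasurableSpace E] [BorelSpace E] (μ : Measure E)
    [μ.IsAddHaarMeasure] {φ : E → ℝ} (hφ : ContDiff ℝ 1 φ) (h : E) :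
    ∫⁻ x, ‖φ (x + h) - φ x‖ₑ ∂μ ≤ ‖h‖ₑ * ∫⁻ x, ‖fderiv ℝ φ x‖ₑ ∂μ := by
  have hcont : Continuous (fderiv ℝ φ) := hφ.continuous_fderiv one_ne_zero
  have hpt : ∀ x, ‖φ (x + h) - φ x‖ₑ ≤
      ∫⁻ t in Set.Ioc (0 : ℝ) 1, ‖fderiv ℝ φ (x + t • h)‖ₑ * ‖h‖ₑ := by
    intro x
    have hd : ∀ t ∈ Set.uIcc (0 : ℝ) 1,
        HasDerivAt (fun t : ℝ => φ (x + t • h)) (fderiv ℝ φ (x + t • h) h) t := by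
      intro t _
      have h1 : HasDerivAt (fun t : ℝ => x + t • h) h t := by
        simpa using ((hasDerivAt_id t).smul_const h).const_add x
      exact ((hφ.differentiable one_ne_zero) _).hasFDerivAt.comp_hasDerivAt t h1
    have h2 := intervalIntegral.integral_eq_sub_of_hasDerivAt hd
      (Continuous.intervalIntegrable (by fun_prop) _ _)
    simp only [one_smul, zero_smul, add_zero] at h2
    rw [← h2, intervalIntegral.integral_of_le zero_le_one]
    refine (enorm_integral_le_lintegral_enorm _).trans (lintegral_mono fun t => ?_)
    exact ContinuousLinearMap.le_opENorm _ _
  calc ∫⁻ x, ‖φ (x + h) - φ x‖ₑ ∂μ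
      ≤ ∫⁻ x, (∫⁻ t in Set.Ioc (0 : ℝ) 1, ‖fderiv ℝ φ (x + t • h)‖ₑ * ‖h‖ₑ) ∂μ := lintegral_mono hpt
    _ = ∫⁻ t in Set.Ioc (0 : ℝ) 1, ∫⁻ x, ‖fderiv ℝ φ (x + t • h)‖ₑ * ‖h‖ₑ ∂μ := by
        refine lintegral_lintegral_swap (Continuous.aemeasurable ?_)
        simp only [Function.uncurry_def]
        refine (ENNReal.continuous_mul_const enorm_ne_top).comp ?_
        exact (hcont.comp (by fun_prop)).enorm
    _ = ∫⁻ t in Set.Ioc (0 : ℝ) 1, ‖h‖ₑ * ∫⁻ x, ‖fderiv ℝ φ x‖ₑ ∂μ := by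
        refine lintegral_congr fun t => ?_
        rw [lintegral_mul_const _ (by fun_prop), mul_comm,
          lintegral_add_right_eq_self (fun x => ‖fderiv ℝ φ x‖ₑ)]
    _ = _ := by simp

theorem lintegral_enorm_mollify_sub_le {E : Type*} [NormedAddCommGroup E] [NormedSpace ℝ E]
    [FiniteDimensional ℝ E] [MeasurableSpace E] [BorelSpace E] (μ : Measure E)
    [μ.IsAddHaarMeasure] {φ ρ : E → ℝ} (hφ : ContDiff ℝ 1 φ)
    (hρ : Continuous ρ) (hρc : HasCompactSupport ρ) (hρ0 : ∀ x, 0 ≤ ρ x)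
    (hρ1 : ∫ x, ρ x ∂μ = 1) {δ : ℝ} (hρδ : ∀ x, ρ x ≠ 0 → ‖x‖ ≤ δ) :
    ∫⁻ x, ‖(∫ y, φ y * ρ (x - y) ∂μ) - φ x‖ₑ ∂μ ≤
      ENNReal.ofReal δ * ∫⁻ x, ‖fderiv ℝ φ x‖ₑ ∂μ := by
  have hpt : ∀ x, ‖(∫ y, φ y * ρ (x - y) ∂μ) - φ x‖ₑ ≤
      ∫⁻ y, ‖ρ y‖ₑ * ‖φ (x + -y) - φ x‖ₑ ∂μ := by
    intro x
    have e1 : ∫ y, φ y * ρ (x - y) ∂μ = ∫ y, φ (x - y) * ρ y ∂μ := by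
      rw [← integral_sub_left_eq_self (fun y => φ (x - y) * ρ y) μ x]
      simp
    have i1 : Integrable (fun y => φ (x - y) * ρ y) μ :=
      Continuous.integrable_of_hasCompactSupport
        ((hφ.continuous.comp (by fun_prop)).mul hρ) hρc.mul_left
    have i2 : Integrable (fun y => φ x * ρ y) μ :=
      (hρ.integrable_of_hasCompactSupport hρc).const_mul _
    have e2 : φ x = ∫ y, φ x * ρ y ∂μ := by rw [integral_const_mul, hρ1, mul_one]
    rw [e1]
    have e3 : ∫ y, φ (x - y) * ρ y ∂μ - φ x = ∫ y, (φ (x - y) * ρ y - φ x * ρ y) ∂μ := by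
      rw [integral_sub i1 i2, ← e2]
    rw [e3]
    refine (enorm_integral_le_lintegral_enorm _).trans (lintegral_mono fun y => ?_)
    rw [← sub_mul, enorm_mul, mul_comm, sub_eq_add_neg x y]
  calc ∫⁻ x, ‖(∫ y, φ y * ρ (x - y) ∂μ) - φ x‖ₑ ∂μ
      ≤ ∫⁻ x, ∫⁻ y, ‖ρ y‖ₑ * ‖φ (x + -y) - φ x‖ₑ ∂μ ∂μ := lintegral_mono hpt
    _ = ∫⁻ y, ∫⁻ x, ‖ρ y‖ₑ * ‖φ (x + -y) - φ x‖ₑ ∂μ ∂μ := by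
        refine lintegral_lintegral_swap (Measurable.aemeasurable ?_)
        have := hφ.continuous.measurable
        have := hρ.measurable
        simp only [Function.uncurry_def]
        fun_prop
    _ ≤ ∫⁻ y, ‖ρ y‖ₑ * (ENNReal.ofReal δ * ∫⁻ x, ‖fderiv ℝ φ x‖ₑ ∂μ) ∂μ := by
        refine lintegral_mono fun y => ?_
        rw [lintegral_const_mul' _ _ enorm_ne_top]
        by_cases hy : ρ y = 0
        · simp [hy]
        · refine mul_le_mul_right ((lintegral_enorm_sub_translate_le μ hφ (-y)).trans ?_) _
          refine mul_le_mul_left ?_ _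
          rw [enorm_neg, ← ofReal_norm]
          exact ENNReal.ofReal_le_ofReal (hρδ y hy)
    _ = _ := by
        rw [lintegral_mul_const _ (by fun_prop)]
        have : ∫⁻ y, ‖ρ y‖ₑ ∂μ = 1 := by
          rw [← ENNReal.ofReal_one, ← hρ1, ofReal_integral_eq_lintegral_ofReal
            (hρ.integrable_of_hasCompactSupport hρc) (Eventually.of_forall hρ0)]
          refine lintegral_congr fun y => ?_
          rw [← ofReal_norm, Real.norm_of_nonneg (hρ0 y)]
        rw [this, one_mul]

theorem ENNReal.exists_pos_mul_ofReal_lt {K ε : ℝ≥0∞} (hK : K ≠ ⊤) (hε : ε ≠ 0) :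
    ∃ δ : ℝ, 0 < δ ∧ K * ENNReal.ofReal δ < ε := by
  have h1 : Tendsto (fun δ : ℝ => K * ENNReal.ofReal δ) (𝓝[>] 0) (𝓝 0) := by
    have := (ENNReal.tendsto_ofReal (tendsto_id (α := ℝ) (x := 𝓝 0)))
    have := ENNReal.Tendsto.const_mul (a := K) this (Or.inr hK)
    simp only [id, ENNReal.ofReal_zero, mul_zero] at this
    exact this.mono_left nhdsWithin_le_nhds
  obtain ⟨δ, h, h'⟩ := ((h1.eventually (gt_mem_nhds (pos_iff_ne_zero.2 hε))).and
    self_mem_nhdsWithin).exists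
  exact ⟨δ, h', h⟩

/-- Rellich's theorem in `L¹` for compactly supported `C¹` functions: a sequence carried by a fixed
ball and bounded in `W^{1,1}` has a subsequence converging in `L¹`. Mollification at scale `δ` moves
each member by at most `δ` times the bound of the gradients, and the mollifications converge
pointwise along a weak-* convergent subsequence. -/
theorem exists_subseq_tendsto_eLpNorm_one {E : Type*} [NormedAddCommGroup E] [NormedSpace ℝ E]
    [FiniteDimensional ℝ E] [MeasurableSpace E] [BorelSpace E] {μ : Measure E}
    [μ.IsAddHaarMeasure] {R : ℝ} {φ : ℕ → E → ℝ} (hφ : ∀ n, ContDiff ℝ 1 (φ n))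
    (hφR : ∀ n, tsupport (φ n) ⊆ Metric.closedBall 0 R) {C : ℝ≥0∞} (hCtop : C ≠ ⊤)
    (hC : ∀ n, ∫⁻ x, ‖φ n x‖ₑ ∂μ ≤ C) (hC' : ∀ n, ∫⁻ x, ‖fderiv ℝ (φ n) x‖ₑ ∂μ ≤ C) :
    ∃ σ : ℕ → ℕ, StrictMono σ ∧ ∃ w : E → ℝ, MemLp w 1 μ ∧
      Tendsto (fun n => eLpNorm (fun x => φ (σ n) x - w x) 1 μ) atTop (𝓝 0) := by
  have : ProperSpace E := FiniteDimensional.proper_real E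
  have hφc : ∀ n, HasCompactSupport (φ n) := fun n =>
    (isCompact_closedBall (0 : E) R).of_isClosed_subset (isClosed_tsupport _) (hφR n)
  have hφi : ∀ n, Integrable (φ n) μ := fun n =>
    (hφ n).continuous.integrable_of_hasCompactSupport (hφc n)
  have hφ0 : ∀ n x, x ∉ Metric.closedBall (0 : E) R → φ n x = 0 := fun n x hx =>
    image_eq_zero_of_notMem_tsupport fun h => hx (hφR n h)
  have hCr : ∀ n, ∫ x, ‖φ n x‖ ∂μ ≤ C.toReal := fun n => by
    rw [integral_norm_eq_lintegral_enorm (hφi n).1]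
    exact ENNReal.toReal_mono hCtop (hC n)
  obtain ⟨σ, hσ, hlim⟩ := exists_subseq_tendsto_integral_mul
    (isCompact_closedBall (0 : E) R) hφi hφ0 hCr
  refine ⟨σ, hσ, ?_⟩
  have hmem : ∀ n, MemLp (φ n) 1 μ := fun n => memLp_one_iff_integrable.2 (hφi n)
  have hcauchy : CauchySeq fun n => (hmem (σ n)).toLp (φ (σ n)) := by
    rw [EMetric.cauchySeq_iff]
    intro ε hε
    obtain ⟨δ, hδ0, hδ⟩ := ENNReal.exists_pos_mul_ofReal_lt (ε := ε / 3) hCtop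
      (ENNReal.div_pos hε.ne' (by simp)).ne'
    rw [mul_comm] at hδ
    let β : ContDiffBump (0 : E) := ⟨δ / 2, δ, half_pos hδ0, half_lt_self hδ0⟩
    let ρ : E → ℝ := β.normed μ
    have hρc : HasCompactSupport ρ := β.hasCompactSupport_normed
    have hρ : Continuous ρ := β.continuous_normed
    have hρδ : ∀ x, ρ x ≠ 0 → ‖x‖ ≤ δ := by
      intro x hx
      have : x ∈ Function.support ρ := hx
      rw [β.support_normed_eq] at this
      exact (mem_ball_zero_iff.1 this).le
    obtain ⟨S, hS⟩ := hρ.bounded_above_of_compact_support hρc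
    have hS0 : 0 ≤ S := (norm_nonneg _).trans (hS 0)
    let a : ℕ → E → ℝ := fun n x => ∫ y, φ (σ n) y * ρ (x - y) ∂μ
    have hac : ∀ n, Continuous (a n) := fun n =>
      HasCompactSupport.continuous_convolution_right (ContinuousLinearMap.mul ℝ ℝ) hρc
        (hφi (σ n)).locallyIntegrable hρ
    have ha1 : ∀ n, ∫⁻ x, ‖a n x - φ (σ n) x‖ₑ ∂μ < ε / 3 := fun n =>
      (lintegral_enorm_mollify_sub_le μ (hφ _) hρ hρc β.nonneg_normed
        β.integral_normed hρδ).trans_lt ((mul_le_mul_right (hC' _) _).trans_lt hδ)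
    have hconv : ∀ x, ∃ l, Tendsto (fun n => a n x) atTop (𝓝 l) := fun x =>
      hlim (fun y => ρ (x - y)) (by fun_prop)
    choose b hb using hconv
    have hab : Tendsto (fun n => ∫⁻ x, ‖a n x - b x‖ₑ ∂μ) atTop (𝓝 0) := by
      have hbnd : ∀ n x, ‖a n x‖ ≤ (Metric.closedBall (0 : E) (R + δ)).indicator
          (fun _ => C.toReal * S) x := by
        intro n x
        by_cases hx : x ∈ Metric.closedBall (0 : E) (R + δ)
        · rw [Set.indicator_of_mem hx]
          refine (norm_integral_le_integral_norm _).trans ?_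
          calc ∫ y, ‖φ (σ n) y * ρ (x - y)‖ ∂μ ≤ ∫ y, ‖φ (σ n) y‖ * S ∂μ := by
                refine integral_mono_of_nonneg (Eventually.of_forall fun y => norm_nonneg _)
                  ((hφi _).norm.mul_const S) (Eventually.of_forall fun y => ?_)
                simp only [norm_mul]
                exact mul_le_mul_of_nonneg_left (hS _) (norm_nonneg _)
            _ ≤ C.toReal * S := by
                rw [integral_mul_const]
                exact mul_le_mul_of_nonneg_right (hCr _) hS0
        · rw [Set.indicator_of_notMem hx]
          have h0 : ∀ y, φ (σ n) y * ρ (x - y) = 0 := by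
            intro y
            by_contra hne
            have h1 : y ∈ Metric.closedBall (0 : E) R := by
              by_contra hy
              exact hne (by rw [hφ0 _ y hy, zero_mul])
            have h2 : ‖x - y‖ ≤ δ := hρδ _ (right_ne_zero_of_mul hne)
            refine hx ?_
            rw [mem_closedBall_zero_iff] at h1 ⊢
            have := norm_add_le (x - y) y
            rw [sub_add_cancel] at this
            linarith
          simp only [a, h0, integral_zero, norm_zero, le_refl]
      have hbm : AEStronglyMeasurable b μ :=
        aestronglyMeasurable_of_tendsto_ae atTop (fun n => (hac n).aestronglyMeasurable)
          (Eventually.of_forall hb)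
      have h1 := tendsto_lintegral_norm_of_dominated_convergence (μ := μ) (F := a) (f := b)
        (bound := (Metric.closedBall (0 : E) (R + δ)).indicator (fun _ => C.toReal * S))
        (fun n => (hac n).aestronglyMeasurable)
        ((integrable_indicator_iff Metric.isClosed_closedBall.measurableSet).2
          (integrableOn_const (isCompact_closedBall _ _).measure_lt_top.ne)).2
        (fun n => Eventually.of_forall (hbnd n)) (Eventually.of_forall hb)
      simpa only [ofReal_norm] using h1
    have h6 : 0 < ε / 3 / 2 := ENNReal.half_pos (ENNReal.div_pos hε.ne' (by simp)).ne'
    obtain ⟨N, hN⟩ := eventually_atTop.1 (hab.eventually (gt_mem_nhds h6))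
    refine ⟨N, fun m hm n hn => ?_⟩
    have hmb : ∀ n, AEMeasurable (fun x => ‖a n x - b x‖ₑ) μ := fun n => by
      have hbm : AEStronglyMeasurable b μ :=
        aestronglyMeasurable_of_tendsto_ae atTop (fun n => (hac n).aestronglyMeasurable)
          (Eventually.of_forall hb)
      exact ((hac n).aestronglyMeasurable.sub hbm).enorm
    have hma : ∀ n, Measurable (fun x => ‖a n x - φ (σ n) x‖ₑ) := fun n =>
      (((hac n).sub (hφ _).continuous).enorm).measurable
    rw [Lp.edist_toLp_toLp, eLpNorm_one_eq_lintegral_enorm]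
    calc ∫⁻ x, ‖(φ (σ m) - φ (σ n)) x‖ₑ ∂μ
        ≤ ∫⁻ x, (‖a m x - φ (σ m) x‖ₑ + ‖a n x - φ (σ n) x‖ₑ
            + (‖a m x - b x‖ₑ + ‖a n x - b x‖ₑ)) ∂μ := by
          refine lintegral_mono fun x => ?_
          have e : (φ (σ m) - φ (σ n)) x = -(a m x - φ (σ m) x) + (a n x - φ (σ n) x)
              + ((a m x - b x) + -(a n x - b x)) := by
            simp only [Pi.sub_apply]; ring
          rw [e]
          refine (enorm_add_le _ _).trans (add_le_add ((enorm_add_le _ _).trans ?_)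
            ((enorm_add_le _ _).trans ?_)) <;> rw [enorm_neg]
      _ = ∫⁻ x, ‖a m x - φ (σ m) x‖ₑ ∂μ + ∫⁻ x, ‖a n x - φ (σ n) x‖ₑ ∂μ
            + (∫⁻ x, ‖a m x - b x‖ₑ ∂μ + ∫⁻ x, ‖a n x - b x‖ₑ ∂μ) := by
          have hadd : Measurable fun x => ‖a m x - φ (σ m) x‖ₑ + ‖a n x - φ (σ n) x‖ₑ :=
            (hma m).add (hma n)
          rw [lintegral_add_left hadd, lintegral_add_left (hma m),
            lintegral_add_left' (hmb m)]
      _ < (ε / 3 + ε / 3) + (ε / 3 / 2 + ε / 3 / 2) := by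
          exact ENNReal.add_lt_add (ENNReal.add_lt_add (ha1 m) (ha1 n))
            (ENNReal.add_lt_add (hN m hm) (hN n hn))
      _ = ε := by rw [ENNReal.add_halves, ENNReal.add_thirds]
  obtain ⟨w, hw⟩ := cauchySeq_tendsto_of_complete hcauchy
  refine ⟨w, Lp.memLp w, ?_⟩
  have h1 := tendsto_iff_edist_tendsto_0.1 hw
  refine h1.congr fun n => ?_
  rw [Lp.edist_def]
  refine eLpNorm_congr_ae ?_
  filter_upwards [(hmem (σ n)).coeFn_toLp] with x hx
  simp [hx]

/-! ### Estimates along lines -/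

theorem lintegral_line_eq_setLIntegral {E : Type*} [NormedAddCommGroup E] [NormedSpace ℝ E]
    {F : E → ℝ≥0∞} (hF : ∀ x, x ∉ Metric.ball (0 : E) 1 → F x = 0) {e : E} (he : ‖e‖ = 1) {x : E}
    (hx : x ∈ Metric.ball (0 : E) 1) :
    ∫⁻ s : ℝ, F (x + s • e) = ∫⁻ s in Set.Icc (-2 : ℝ) 2, F (x + s • e) := by
  rw [← lintegral_indicator measurableSet_Icc]
  refine lintegral_congr fun s => ?_
  by_cases hs : s ∈ Set.Icc (-2 : ℝ) 2
  · rw [Set.indicator_of_mem hs]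
  · rw [Set.indicator_of_notMem hs]
    refine hF _ fun h => hs ?_
    rw [mem_ball_zero_iff] at h hx
    have h1 : |s| ≤ ‖x + s • e‖ + ‖x‖ := by
      have := norm_sub_le (x + s • e) x
      rwa [add_sub_cancel_left, norm_smul, he, mul_one, Real.norm_eq_abs] at this
    exact abs_le.1 (by linarith)

/-- Minkowski's inequality for integrals along lines, for functions vanishing outside the ball. -/
theorem lintegral_rpow_line_le {E : Type*} [NormedAddCommGroup E] [NormedSpace ℝ E]
    [FiniteDimensional ℝ E] [MeasurableSpace E] [BorelSpace E] (μ : Measure E)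
    [μ.IsAddHaarMeasure] {F : E → ℝ≥0∞} (hFm : Measurable F)
    (hF : ∀ x, x ∉ Metric.ball (0 : E) 1 → F x = 0) {e : E} (he : ‖e‖ = 1) {p : ℝ} (hp : 1 ≤ p) :
    ∫⁻ x in Metric.ball (0 : E) 1, (∫⁻ s : ℝ, F (x + s • e)) ^ p ∂μ ≤
      4 ^ p * ∫⁻ x, F x ^ p ∂μ := by
  have hp0 : 0 < p := by linarith
  have hvol : volume (Set.Icc (-2 : ℝ) 2) = 4 := by rw [Real.volume_Icc]; norm_num
  have hJ : ∀ x ∈ Metric.ball (0 : E) 1, (∫⁻ s : ℝ, F (x + s • e)) ^ p ≤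
      4 ^ (p - 1) * ∫⁻ s in Set.Icc (-2 : ℝ) 2, F (x + s • e) ^ p := by
    intro x hx
    rw [lintegral_line_eq_setLIntegral hF he hx]
    have hm : AEMeasurable (fun s : ℝ => F (x + s • e)) (volume.restrict (Set.Icc (-2 : ℝ) 2)) :=
      (hFm.comp (by fun_prop)).aemeasurable
    rcases hp.eq_or_lt with rfl | hp1
    · simp
    have hpq := Real.HolderConjugate.conjExponent hp1
    have h1 := ENNReal.lintegral_mul_le_Lp_mul_Lq (volume.restrict (Set.Icc (-2 : ℝ) 2)) hpq hm
      (aemeasurable_const (b := (1 : ℝ≥0∞)))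
    simp only [Pi.mul_apply, mul_one, ENNReal.one_rpow, lintegral_const, one_mul,
      Measure.restrict_apply MeasurableSet.univ, Set.univ_inter, hvol] at h1
    refine (ENNReal.rpow_le_rpow h1 hp0.le).trans_eq ?_
    rw [ENNReal.mul_rpow_of_nonneg _ _ hp0.le, ← ENNReal.rpow_mul, ← ENNReal.rpow_mul,
      one_div_mul_cancel hp0.ne', ENNReal.rpow_one, mul_comm]
    congr 2
    rw [Real.conjExponent]
    have : p - 1 ≠ 0 := by linarith
    field_simp
  calc ∫⁻ x in Metric.ball (0 : E) 1, (∫⁻ s : ℝ, F (x + s • e)) ^ p ∂μ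
      ≤ ∫⁻ x in Metric.ball (0 : E) 1,
          4 ^ (p - 1) * (∫⁻ s in Set.Icc (-2 : ℝ) 2, F (x + s • e) ^ p) ∂μ :=
        setLIntegral_mono' measurableSet_ball hJ
    _ ≤ ∫⁻ x, 4 ^ (p - 1) * (∫⁻ s in Set.Icc (-2 : ℝ) 2, F (x + s • e) ^ p) ∂μ :=
        setLIntegral_le_lintegral _ _
    _ = 4 ^ (p - 1) * ∫⁻ x, (∫⁻ s in Set.Icc (-2 : ℝ) 2, F (x + s • e) ^ p) ∂μ :=
        lintegral_const_mul' _ _ (ENNReal.rpow_ne_top_of_nonneg (by linarith) (by simp))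
    _ = 4 ^ (p - 1) * ∫⁻ s in Set.Icc (-2 : ℝ) 2, (∫⁻ x, F (x + s • e) ^ p ∂μ) := by
        rw [lintegral_lintegral_swap (Measurable.aemeasurable ?_)]
        simp only [Function.uncurry_def]
        exact (hFm.comp (by fun_prop)).pow_const p
    _ = 4 ^ (p - 1) * ∫⁻ s in Set.Icc (-2 : ℝ) 2, (∫⁻ x, F x ^ p ∂μ) := by
        congr 1
        refine lintegral_congr fun s => ?_
        exact lintegral_add_right_eq_self (fun x => F x ^ p) _
    _ = _ := by
        rw [lintegral_const, Measure.restrict_apply MeasurableSet.univ, Set.univ_inter, hvol,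
          mul_comm _ (4 : ℝ≥0∞), ← mul_assoc]
        congr 1
        nth_rewrite 2 [← ENNReal.rpow_one 4]
        rw [← ENNReal.rpow_add _ _ (by simp) (by simp)]
        congr 1; ring

/-- A function dominated on the ball by the line integrals of `|f|` is bounded in `L^p` by four
times the norm of `f`: the lines meet the ball within distance two of a point of the ball. -/
theorem eLpNorm_le_of_enorm_le_line {E : Type*} [NormedAddCommGroup E] [NormedSpace ℝ E]
    [FiniteDimensional ℝ E] [MeasurableSpace E] [BorelSpace E] (μ : Measure E)
    [μ.IsAddHaarMeasure] {v f : E → ℝ} (hf : Measurable f)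
    (hf0 : ∀ x, x ∉ Metric.ball (0 : E) 1 → f x = 0) {e : E} (he : ‖e‖ = 1) {p : ℝ} (hp : 1 ≤ p)
    (hv : ∀ᵐ x ∂μ.restrict (Metric.ball 0 1), ‖v x‖ₑ ≤ ∫⁻ s : ℝ, ‖f (x + s • e)‖ₑ) :
    eLpNorm v (ENNReal.ofReal p) (μ.restrict (Metric.ball 0 1)) ≤
      4 * eLpNorm f (ENNReal.ofReal p) (μ.restrict (Metric.ball 0 1)) := by
  have hp0 : 0 < p := by linarith
  have hpne : ENNReal.ofReal p ≠ 0 := by simpa using hp0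
  rw [eLpNorm_eq_lintegral_rpow_enorm_toReal hpne (by simp),
    eLpNorm_eq_lintegral_rpow_enorm_toReal hpne (by simp), ENNReal.toReal_ofReal hp0.le]
  have h0 : ∫⁻ x in Metric.ball (0 : E) 1, ‖f x‖ₑ ^ p ∂μ = ∫⁻ x, ‖f x‖ₑ ^ p ∂μ := by
    rw [← lintegral_indicator measurableSet_ball]
    refine lintegral_congr fun x => ?_
    by_cases hx : x ∈ Metric.ball (0 : E) 1
    · rw [Set.indicator_of_mem hx]
    · rw [Set.indicator_of_notMem hx, hf0 x hx, enorm_zero, ENNReal.zero_rpow_of_pos hp0]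
  have h1 := lintegral_rpow_line_le μ (F := fun x => ‖f x‖ₑ) hf.enorm
    (fun x hx => by simp [hf0 x hx]) he hp
  have h2 : ∫⁻ x in Metric.ball (0 : E) 1, ‖v x‖ₑ ^ p ∂μ ≤
      4 ^ p * ∫⁻ x in Metric.ball (0 : E) 1, ‖f x‖ₑ ^ p ∂μ := by
    rw [h0]
    exact (lintegral_mono_ae (hv.mono fun x hx => ENNReal.rpow_le_rpow hx hp0.le)).trans h1
  refine (ENNReal.rpow_le_rpow h2 (by positivity)).trans_eq ?_
  rw [ENNReal.mul_rpow_of_nonneg _ _ (by positivity), ← ENNReal.rpow_mul,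
    mul_one_div_cancel hp0.ne', ENNReal.rpow_one]

theorem enorm_le_lintegral_line_fderiv {E : Type*} [NormedAddCommGroup E] [NormedSpace ℝ E]
    {φ : E → ℝ} (hφ : ContDiff ℝ 1 φ) (hφc : HasCompactSupport φ) {e : E} (he : e ≠ 0)
    (x : E) : ‖φ x‖ₑ ≤ ∫⁻ s : ℝ, ‖fderiv ℝ φ (x + s • e) e‖ₑ := by
  have hemb : Topology.IsClosedEmbedding fun s : ℝ => x + s • e :=
    (Homeomorph.addLeft x).isClosedEmbedding.comp (isClosedEmbedding_smul_left he)
  have hd : ∀ s : ℝ, deriv (φ ∘ fun s : ℝ => x + s • e) s = fderiv ℝ φ (x + s • e) e := by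
    intro s
    have h1 : HasDerivAt (fun t : ℝ => x + t • e) e s := by
      simpa using ((hasDerivAt_id s).smul_const e).const_add x
    exact (((hφ.differentiable one_ne_zero) _).hasFDerivAt.comp_hasDerivAt s h1).deriv
  have h := HasCompactSupport.enorm_le_lintegral_Ici_deriv (f := φ ∘ fun s : ℝ => x + s • e)
    (hφ.comp (by fun_prop)) (hφc.comp_isClosedEmbedding hemb) 0
  simp only [Function.comp_apply, zero_smul, add_zero] at h
  refine h.trans ((setLIntegral_le_lintegral _ _).trans_eq ?_)
  exact lintegral_congr fun s => by rw [hd]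

/-- A function with integrable weak derivative `f` in the direction `e` satisfies the fundamental
theorem of calculus on almost every segment in that direction. -/
theorem ae_sub_translate_eq_integral_of_weak_deriv {E : Type*} [NormedAddCommGroup E]
    [NormedSpace ℝ E] [FiniteDimensional ℝ E] [MeasurableSpace E] [BorelSpace E] (μ : Measure E)
    [μ.IsAddHaarMeasure] {v f : E → ℝ} (hv : Integrable v μ) (hf : Integrable f μ)
    (hfm : Measurable f) {U : Set E} (hU : IsOpen U) (hUc : Convex ℝ U) {e : E}
    (hweak : ∀ ψ : E → ℝ, ContDiff ℝ ∞ ψ → HasCompactSupport ψ → tsupport ψ ⊆ U →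
      ∫ x, v x * fderiv ℝ ψ x e ∂μ = - ∫ x, f x * ψ x ∂μ) (t : ℝ) :
    ∀ᵐ x ∂μ, x ∈ U → x + t • e ∈ U →
      v (x + t • e) - v x = ∫ s in Set.Ioc (0 : ℝ) 1, t * f (x + (s * t) • e) := by
  let W : Set E := U ∩ {x | x + t • e ∈ U}
  have hW : IsOpen W := hU.inter (hU.preimage (by fun_prop))
  let ν : Measure ℝ := volume.restrict (Set.Ioc (0 : ℝ) 1)
  have hvt : ∀ a : E, Integrable (fun x => v (x + a)) μ := fun a => hv.comp_add_right a
  have hft : ∀ a : E, Integrable (fun x => f (x + a)) μ := fun a => hf.comp_add_right a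
  -- the shifted copies of `f` are jointly integrable
  have hfprod : Integrable (fun z : E × ℝ => t * f (z.1 + (z.2 * t) • e)) (μ.prod ν) := by
    refine Integrable.const_mul ?_ t
    have hm : Measurable fun z : E × ℝ => f (z.1 + (z.2 * t) • e) := hfm.comp (by fun_prop)
    rw [integrable_prod_iff' hm.aestronglyMeasurable]
    refine ⟨Eventually.of_forall fun s => hft ((s * t) • e), ?_⟩
    have : (fun s : ℝ => ∫ x, ‖f (x + (s * t) • e)‖ ∂μ) = fun _ => ∫ x, ‖f x‖ ∂μ := by
      ext s
      exact integral_add_right_eq_self (fun x => ‖f x‖) _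
    rw [this]
    exact integrable_const _
  let g : E → ℝ := fun x => v (x + t • e) - v x - ∫ s in Set.Ioc (0 : ℝ) 1, t * f (x + (s * t) • e)
  have hg : Integrable g μ := ((hvt _).sub hv).sub hfprod.integral_prod_left
  have hmain : ∀ᵐ x ∂μ, x ∈ W → g x = 0 := by
    refine hW.ae_eq_zero_of_integral_contDiff_smul_eq_zero
      (hg.locallyIntegrable.locallyIntegrableOn W)
      fun ψ hψ hψc hψW => ?_
    simp only [smul_eq_mul]
    obtain ⟨S, hS⟩ := hψ.continuous.bounded_above_of_compact_support hψc
    have hψ1 : ContDiff ℝ 1 ψ := hψ.of_le (by exact_mod_cast le_top)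
    have hdc : Continuous fun x => fderiv ℝ ψ x := hψ1.continuous_fderiv one_ne_zero
    obtain ⟨S', hS'⟩ := hdc.bounded_above_of_compact_support (hψc.fderiv ℝ)
    have hbd : ∀ F : E → ℝ, Integrable F μ → Integrable (fun x => ψ x * F x) μ := fun F hF =>
      hF.bdd_mul hψ.continuous.aestronglyMeasurable (Eventually.of_forall hS)
    -- derivative of the shifted test function, integrated against `v`
    have hshift : ∀ s ∈ Set.Ioc (0 : ℝ) 1,
        ∫ x, v x * fderiv ℝ ψ (x - (s * t) • e) e ∂μ =
          - ∫ x, f x * ψ (x - (s * t) • e) ∂μ := by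
      intro s hs
      have hfd : ∀ x, fderiv ℝ (fun x => ψ (x - (s * t) • e)) x =
          fderiv ℝ ψ (x - (s * t) • e) := fun x => by
        rw [fderiv_comp_sub]
      have h := hweak (fun x => ψ (x - (s * t) • e)) (hψ.comp (by fun_prop))
        (hψc.comp_homeomorph (Homeomorph.subRight ((s * t) • e))) ?_
      · simpa only [hfd] using h
      · have hts : tsupport (fun x => ψ (x - (s * t) • e)) ⊆
            (fun x => x - (s * t) • e) ⁻¹' tsupport ψ :=
          tsupport_comp_subset_preimage ψ (by fun_prop)
        intro x hx
        have hy := hψW (hts hx)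
        -- `x` lies on the segment between the two points of `U` given by `y ∈ W`
        have hc := hUc hy.1 hy.2 (by linarith [hs.2] : 0 ≤ 1 - s) hs.1.le (by ring)
        have e1 : (1 - s) • (x - (s * t) • e) + s • (x - (s * t) • e + t • e) = x := by
          module
        rwa [e1] at hc
    have hftc : ∀ x, ψ (x - t • e) - ψ x =
        ∫ s in Set.Ioc (0 : ℝ) 1, -(t * fderiv ℝ ψ (x - (s * t) • e) e) := by
      intro x
      have hd : ∀ s ∈ Set.uIcc (0 : ℝ) 1, HasDerivAt (fun s : ℝ => ψ (x - (s * t) • e))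
          (-(t * fderiv ℝ ψ (x - (s * t) • e) e)) s := by
        intro s _
        have h1 : HasDerivAt (fun s : ℝ => x - (s * t) • e) (-(t • e)) s := by
          simpa using (((hasDerivAt_id s).mul_const t).smul_const e).const_sub x
        have h2 := ((hψ1.differentiable one_ne_zero) _).hasFDerivAt.comp_hasDerivAt s h1
        simpa [Function.comp_def] using h2
      have h2 := intervalIntegral.integral_eq_sub_of_hasDerivAt hd
        (Continuous.intervalIntegrable (by fun_prop) _ _)
      rw [intervalIntegral.integral_of_le zero_le_one] at h2
      simpa using h2.symm
    have hprod1 : Integrable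
        (fun z : E × ℝ => v z.1 * -(t * fderiv ℝ ψ (z.1 - (z.2 * t) • e) e)) (μ.prod ν) := by
      refine (hv.comp_fst ν).mul_bdd (c := |t| * (S' * ‖e‖)) ?_
        (Eventually.of_forall fun z => ?_)
      · exact Continuous.aestronglyMeasurable (by fun_prop)
      · rw [norm_neg, norm_mul, Real.norm_eq_abs]
        refine mul_le_mul_of_nonneg_left ?_ (abs_nonneg t)
        exact (ContinuousLinearMap.le_opNorm _ _).trans
          (mul_le_mul_of_nonneg_right (hS' _) (norm_nonneg _))
    have hprod2 : Integrable (fun z : E × ℝ => ψ z.1 * (t * f (z.1 + (z.2 * t) • e)))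
        (μ.prod ν) :=
      hfprod.bdd_mul (hψ.continuous.comp continuous_fst).aestronglyMeasurable
        (Eventually.of_forall fun z => hS z.1)
    have hA : ∫ x, ψ x * (v (x + t • e) - v x) ∂μ =
        ∫ x, ψ x * (∫ s in Set.Ioc (0 : ℝ) 1, t * f (x + (s * t) • e)) ∂μ := by
      calc ∫ x, ψ x * (v (x + t • e) - v x) ∂μ
          = ∫ x, v x * (ψ (x - t • e) - ψ x) ∂μ := by
            simp only [mul_sub]
            have i3 : Integrable (fun x => v x * ψ (x - t • e)) μ :=
              hv.mul_bdd (hψ.continuous.comp (by fun_prop)).aestronglyMeasurable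
                (Eventually.of_forall fun x => hS _)
            have i4 : Integrable (fun x => v x * ψ x) μ :=
              hv.mul_bdd hψ.continuous.aestronglyMeasurable (Eventually.of_forall fun x => hS _)
            rw [integral_sub (hbd _ (hvt _)) (hbd _ hv), integral_sub i3 i4]
            congr 1
            · rw [← integral_sub_right_eq_self (fun x => ψ x * v (x + t • e)) (t • e)]
              simp only [sub_add_cancel, mul_comm]
            · simp only [mul_comm]
        _ = ∫ x, (∫ s in Set.Ioc (0 : ℝ) 1,
              v x * -(t * fderiv ℝ ψ (x - (s * t) • e) e)) ∂μ := by
            refine integral_congr_ae (Eventually.of_forall fun x => ?_)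
            simp only [hftc x, integral_const_mul]
        _ = ∫ s in Set.Ioc (0 : ℝ) 1,
              (∫ x, v x * -(t * fderiv ℝ ψ (x - (s * t) • e) e) ∂μ) :=
            integral_integral_swap hprod1
        _ = ∫ s in Set.Ioc (0 : ℝ) 1, (∫ x, ψ x * (t * f (x + (s * t) • e)) ∂μ) := by
            refine setIntegral_congr_fun measurableSet_Ioc fun s hs => ?_
            have e1 : ∀ x, v x * -(t * fderiv ℝ ψ (x - (s * t) • e) e) =
                -t * (v x * fderiv ℝ ψ (x - (s * t) • e) e) := fun x => by ring
            have e2 : ∀ x, ψ x * (t * f (x + (s * t) • e)) =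
                t * (f (x + (s * t) • e) * ψ x) := fun x => by ring
            simp only [e1, e2, integral_const_mul, hshift s hs]
            rw [← integral_sub_right_eq_self (fun x => f (x + (s * t) • e) * ψ x) ((s * t) • e)]
            simp only [sub_add_cancel]
            ring
        _ = ∫ x, (∫ s in Set.Ioc (0 : ℝ) 1, ψ x * (t * f (x + (s * t) • e))) ∂μ :=
            (integral_integral_swap hprod2).symm
        _ = _ := by simp only [integral_const_mul]
    have i5 : Integrable (fun x => ψ x * (v (x + t • e) - v x)) μ := hbd _ ((hvt _).sub hv)
    have i6 : Integrable (fun x => ψ x * (∫ s in Set.Ioc (0 : ℝ) 1, t * f (x + (s * t) • e))) μ :=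
      hbd _ hfprod.integral_prod_left
    simp only [g, mul_sub _ _ (∫ s in Set.Ioc (0 : ℝ) 1, _)]
    rw [integral_sub i5 i6, hA, sub_self]
  filter_upwards [hmain] with x hx h1 h2
  exact sub_eq_zero.1 (hx ⟨h1, h2⟩)

theorem enorm_mul_lintegral_comp_mul_le (t : ℝ) {F : ℝ → ℝ≥0∞} (hF : Measurable F) (s : Set ℝ) :
    ‖t‖ₑ * ∫⁻ x in s, F (x * t) ≤ ∫⁻ x, F x := by
  rcases eq_or_ne t 0 with rfl | ht
  · simp
  calc ‖t‖ₑ * ∫⁻ x in s, F (x * t) ≤ ‖t‖ₑ * ∫⁻ x, F (t * x) := by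
        simp only [mul_comm _ t]
        exact mul_le_mul_right (setLIntegral_le_lintegral _ _) _
    _ = ∫⁻ x, F x := by
        conv_rhs => rw [← Real.smul_map_volume_mul_left ht]
        rw [lintegral_smul_measure, lintegral_map hF (by fun_prop), smul_eq_mul,
          ← ofReal_norm, Real.norm_eq_abs]

/-- The pointwise form of the estimate of a first derivative by a second derivative for functions
vanishing on the boundary. If `v = ∂ₑw` is an `L¹` limit of derivatives of test functions, then `v`
has mean zero on almost every chord of the ball in the direction `e`; if moreover `f` is the weak
derivative of `v` in the direction `e`, then `v` oscillates by at most `∫ |f|` along the chord. -/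
theorem ae_enorm_le_lintegral_line_of_weak_deriv {E : Type*} [NormedAddCommGroup E]
    [NormedSpace ℝ E] [FiniteDimensional ℝ E] [MeasurableSpace E] [BorelSpace E] (μ : Measure E)
    [μ.IsAddHaarMeasure] {v f : E → ℝ} (hv : Integrable v μ) (hvm : Measurable v)
    (hv0 : ∀ x, x ∉ Metric.ball (0 : E) 1 → v x = 0) (hf : Integrable f μ) (hfm : Measurable f)
    {e : E} (he : ‖e‖ = 1)
    (hweak : ∀ ψ : E → ℝ, ContDiff ℝ ∞ ψ → HasCompactSupport ψ →
      tsupport ψ ⊆ Metric.ball 0 1 → ∫ x, v x * fderiv ℝ ψ x e ∂μ = - ∫ x, f x * ψ x ∂μ)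
    (happ : ∀ ε : ℝ≥0∞, ε ≠ 0 → ∃ φ : E → ℝ, ContDiff ℝ ∞ φ ∧ HasCompactSupport φ ∧
      tsupport φ ⊆ Metric.ball 0 1 ∧ ∫⁻ x, ‖v x - fderiv ℝ φ x e‖ₑ ∂μ ≤ ε) :
    ∀ᵐ x ∂μ.restrict (Metric.ball 0 1), ‖v x‖ₑ ≤ ∫⁻ s : ℝ, ‖f (x + s • e)‖ₑ := by
  have he0 : e ≠ 0 := fun h => by simp [h] at he
  let N : E → ℝ≥0∞ := fun x => ∫⁻ s : ℝ, ‖f (x + s • e)‖ₑ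
  have hlinem : ∀ F : E → ℝ, Measurable F → Measurable fun x => ∫⁻ s : ℝ, ‖F (x + s • e)‖ₑ := by
    intro F hF
    have h : Measurable (fun z : E × ℝ => ‖F (z.1 + z.2 • e)‖ₑ) := (hF.comp (by fun_prop)).enorm
    exact h.lintegral_prod_right'
  have hNm : Measurable N := hlinem f hfm
  -- oscillation along chords
  have hosc : ∀ᵐ x ∂μ, ∀ᵐ t : ℝ, x ∈ Metric.ball (0 : E) 1 → x + t • e ∈ Metric.ball (0 : E) 1 →
      ‖v (x + t • e) - v x‖ₑ ≤ N x := by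
    have hms : MeasurableSet {z : E × ℝ | z.1 ∈ Metric.ball (0 : E) 1 →
        z.1 + z.2 • e ∈ Metric.ball (0 : E) 1 → ‖v (z.1 + z.2 • e) - v z.1‖ₑ ≤ N z.1} := by
      have h1 : MeasurableSet {z : E × ℝ | z.1 ∈ Metric.ball (0 : E) 1} :=
        measurable_fst measurableSet_ball
      have h2 : MeasurableSet {z : E × ℝ | z.1 + z.2 • e ∈ Metric.ball (0 : E) 1} := by
        have : Measurable fun z : E × ℝ => z.1 + z.2 • e := by fun_prop
        exact this measurableSet_ball
      have h3 : MeasurableSet {z : E × ℝ | ‖v (z.1 + z.2 • e) - v z.1‖ₑ ≤ N z.1} := by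
        have h4 : Measurable fun z : E × ℝ => v (z.1 + z.2 • e) := hvm.comp (by fun_prop)
        exact measurableSet_le ((h4.sub (hvm.comp measurable_fst)).enorm) (hNm.comp measurable_fst)
      exact h1.imp (h2.imp h3)
    refine (Measure.ae_ae_comm (p := fun (x : E) (t : ℝ) => x ∈ Metric.ball (0 : E) 1 →
      x + t • e ∈ Metric.ball (0 : E) 1 → ‖v (x + t • e) - v x‖ₑ ≤ N x) hms).2 ?_
    refine Eventually.of_forall fun t => ?_
    filter_upwards [ae_sub_translate_eq_integral_of_weak_deriv μ hv hf hfm Metric.isOpen_ball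
      (convex_ball 0 1) hweak t] with x hx h1 h2
    rw [hx h1 h2]
    refine (enorm_integral_le_lintegral_enorm _).trans ?_
    simp only [enorm_mul]
    rw [lintegral_const_mul' _ _ enorm_ne_top]
    exact enorm_mul_lintegral_comp_mul_le t (F := fun s => ‖f (x + s • e)‖ₑ)
      (hfm.comp (by fun_prop)).enorm _
  have hline1 : ∀ F : E → ℝ, Measurable F → (∀ x, x ∉ Metric.ball (0 : E) 1 → F x = 0) →
      ∫⁻ x in Metric.ball (0 : E) 1, (∫⁻ s : ℝ, ‖F (x + s • e)‖ₑ) ∂μ ≤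
        4 * ∫⁻ x, ‖F x‖ₑ ∂μ := by
    intro F hF hF0
    simpa using lintegral_rpow_line_le μ (F := fun x => ‖F x‖ₑ) hF.enorm
      (fun x hx => by simp [hF0 x hx]) he le_rfl
  have hfin : ∀ᵐ x ∂μ.restrict (Metric.ball 0 1), ∫⁻ s : ℝ, ‖v (x + s • e)‖ₑ < ⊤ := by
    refine ae_lt_top (hlinem v hvm) (ne_top_of_le_ne_top ?_ (hline1 v hvm hv0))
    exact ENNReal.mul_ne_top (by simp) hv.2.ne
  -- mean zero along chords
  have hmean : ∀ᵐ x ∂μ.restrict (Metric.ball 0 1), ∫ s : ℝ, v (x + s • e) = 0 := by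
    have hM : Measurable fun x => ‖∫ s : ℝ, v (x + s • e)‖ₑ := by
      have h : StronglyMeasurable (fun z : E × ℝ => v (z.1 + z.2 • e)) :=
        (hvm.comp (by fun_prop)).stronglyMeasurable
      exact h.integral_prod_right'.measurable.enorm
    have h0 : ∫⁻ x in Metric.ball (0 : E) 1, ‖∫ s : ℝ, v (x + s • e)‖ₑ ∂μ = 0 := by
      refine nonpos_iff_eq_zero.1 (le_of_forall_pos_le_add fun ε hε => ?_)
      rw [zero_add]
      obtain ⟨φ, hφ, hφc, hφs, hφε⟩ := happ (ε / 4) (ENNReal.div_pos hε.ne' (by simp)).ne'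
      have hφ1 : ContDiff ℝ 1 φ := hφ.of_le (by exact_mod_cast le_top)
      have hdc : Continuous fun x => fderiv ℝ φ x e :=
        (hφ1.continuous_fderiv one_ne_zero).clm_apply continuous_const
      have hd0 : ∀ x, x ∉ Metric.ball (0 : E) 1 → fderiv ℝ φ x e = 0 := by
        intro x hx
        have : x ∉ tsupport (fderiv ℝ φ) := fun h => hx (hφs (tsupport_fderiv_subset ℝ h))
        rw [image_eq_zero_of_notMem_tsupport this]; rfl
      have hpt : ∀ x, ‖∫ s : ℝ, v (x + s • e)‖ₑ ≤
          ∫⁻ s : ℝ, ‖v (x + s • e) - fderiv ℝ φ (x + s • e) e‖ₑ := by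
        intro x
        by_cases hi : Integrable fun s : ℝ => v (x + s • e)
        · have hemb : Topology.IsClosedEmbedding fun s : ℝ => x + s • e :=
            (Homeomorph.addLeft x).isClosedEmbedding.comp (isClosedEmbedding_smul_left he0)
          have hcs : HasCompactSupport fun s : ℝ => φ (x + s • e) :=
            hφc.comp_isClosedEmbedding hemb
          have hcs' : HasCompactSupport fun s : ℝ => fderiv ℝ φ (x + s • e) e :=
            (hφc.fderiv_apply ℝ e).comp_isClosedEmbedding hemb
          have hi' : Integrable fun s : ℝ => fderiv ℝ φ (x + s • e) e :=
            Continuous.integrable_of_hasCompactSupport (hdc.comp (by fun_prop)) hcs'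
          have hd : ∀ s : ℝ, HasDerivAt (fun s : ℝ => φ (x + s • e))
              (fderiv ℝ φ (x + s • e) e) s := by
            intro s
            have h1 : HasDerivAt (fun t : ℝ => x + t • e) e s := by
              simpa using ((hasDerivAt_id s).smul_const e).const_add x
            exact ((hφ1.differentiable one_ne_zero) _).hasFDerivAt.comp_hasDerivAt s h1
          have hz : ∫ s : ℝ, fderiv ℝ φ (x + s • e) e = 0 :=
            integral_eq_zero_of_hasDerivAt_of_integrable hd hi'
              (Continuous.integrable_of_hasCompactSupport
                (hφ.continuous.comp (by fun_prop)) hcs)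
          have : ∫ s : ℝ, v (x + s • e) =
              ∫ s : ℝ, (v (x + s • e) - fderiv ℝ φ (x + s • e) e) := by
            rw [integral_sub hi hi', hz, sub_zero]
          rw [this]
          exact enorm_integral_le_lintegral_enorm _
        -- where `v` is not integrable along the line, its integral is zero by convention
        · rw [integral_undef hi]; simp
      calc ∫⁻ x in Metric.ball (0 : E) 1, ‖∫ s : ℝ, v (x + s • e)‖ₑ ∂μ
          ≤ ∫⁻ x in Metric.ball (0 : E) 1,
              (∫⁻ s : ℝ, ‖v (x + s • e) - fderiv ℝ φ (x + s • e) e‖ₑ) ∂μ :=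
            lintegral_mono hpt
        _ ≤ 4 * ∫⁻ x, ‖v x - fderiv ℝ φ x e‖ₑ ∂μ :=
            hline1 (fun x => v x - fderiv ℝ φ x e) (hvm.sub hdc.measurable)
              fun x hx => by rw [hv0 x hx, hd0 x hx, sub_zero]
        _ ≤ 4 * (ε / 4) := mul_le_mul_right hφε _
        _ ≤ ε := ENNReal.mul_div_le
    rw [lintegral_eq_zero_iff hM] at h0
    filter_upwards [h0] with x hx
    simpa using hx
  filter_upwards [ae_restrict_of_ae hosc, hfin, hmean, ae_restrict_mem measurableSet_ball]
    with x h1 h2 h3 hx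
  let T : Set ℝ := {t | x + t • e ∈ Metric.ball (0 : E) 1}
  have hTo : IsOpen T := Metric.isOpen_ball.preimage (by fun_prop)
  have hT0 : volume T ≠ 0 := (hTo.measure_pos volume ⟨0, by simpa [T] using hx⟩).ne'
  have hTtop : volume T ≠ ⊤ := by
    have hsub : T ⊆ Set.Icc (-2) 2 := by
      intro t ht
      have h : ‖x + t • e‖ < 1 := mem_ball_zero_iff.1 ht
      rw [mem_ball_zero_iff] at hx
      have h1 : |t| ≤ ‖x + t • e‖ + ‖x‖ := by
        have := norm_sub_le (x + t • e) x
        rwa [add_sub_cancel_left, norm_smul, he, mul_one, Real.norm_eq_abs] at this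
      exact abs_le.1 (by linarith)
    exact ((measure_mono hsub).trans_lt measure_Icc_lt_top).ne
  have hi : Integrable fun s : ℝ => v (x + s • e) :=
    ⟨(hvm.comp (by fun_prop)).aestronglyMeasurable, h2⟩
  have hz : ∫ s in T, v (x + s • e) = 0 := by
    rw [← h3]
    exact setIntegral_eq_integral_of_forall_compl_eq_zero fun s hs => hv0 _ hs
  have heq : volume.real T * v x = - ∫ s in T, (v (x + s • e) - v x) := by
    rw [integral_sub hi.integrableOn (integrableOn_const hTtop), hz, setIntegral_const]
    simp
  have hle : volume T * ‖v x‖ₑ ≤ volume T * N x := by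
    have e1 : volume T * ‖v x‖ₑ = ‖volume.real T * v x‖ₑ := by
      rw [enorm_mul, ← ofReal_norm (volume.real T), Real.norm_of_nonneg measureReal_nonneg,
        ofReal_measureReal hTtop]
    rw [e1, heq, enorm_neg]
    refine (enorm_integral_le_lintegral_enorm _).trans ?_
    calc ∫⁻ s in T, ‖v (x + s • e) - v x‖ₑ ≤ ∫⁻ _ in T, N x := by
          refine lintegral_mono_ae ?_
          filter_upwards [ae_restrict_of_ae h1, ae_restrict_mem hTo.measurableSet] with s hs hsT
            using hs hx hsT
      _ = volume T * N x := by rw [setLIntegral_const, mul_comm]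
  exact (ENNReal.mul_le_mul_iff_right hT0 hTtop).1 hle

/-! ### Calculus of weak derivatives -/

theorem contDiff_partialDeriv {d : ℕ} (i : Fin d) {f : EuclideanSpace ℝ (Fin d) → ℝ}
    (hf : ContDiff ℝ ∞ f) : ContDiff ℝ ∞ (partialDeriv i f) := by
  have h := hf.fderiv_right (m := ∞) (by simp)
  exact h.clm_apply contDiff_const

/-- The partial derivative of a test function, as a test function. -/
noncomputable def partialDerivTest {d : ℕ}
    {Ω : TopologicalSpace.Opens (EuclideanSpace ℝ (Fin d))} (i : Fin d) (φ : 𝓓(Ω, ℝ)) :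
    𝓓(Ω, ℝ) where
  toFun := partialDeriv i φ
  contDiff' := contDiff_partialDeriv i φ.contDiff
  hasCompactSupport' := φ.hasCompactSupport.fderiv_apply ℝ _
  tsupport_subset' := (tsupport_fderiv_apply_subset ℝ _).trans φ.tsupport_subset

theorem coe_partialDerivTest {d : ℕ} {Ω : TopologicalSpace.Opens (EuclideanSpace ℝ (Fin d))}
    (i : Fin d) (φ : 𝓓(Ω, ℝ)) : ⇑(partialDerivTest i φ) = partialDeriv i φ := rfl

theorem partialDeriv_lincomb {d : ℕ} {Ω : TopologicalSpace.Opens (EuclideanSpace ℝ (Fin d))}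
    (i : Fin d) (a b : ℝ) (φ ψ : 𝓓(Ω, ℝ)) (x : EuclideanSpace ℝ (Fin d)) :
    partialDeriv i (a • φ + b • ψ : 𝓓(Ω, ℝ)) x =
      a * partialDeriv i φ x + b * partialDeriv i ψ x := by
  have hφ : DifferentiableAt ℝ φ x := (φ.contDiff.differentiable (by simp)) x
  have hψ : DifferentiableAt ℝ ψ x := (ψ.contDiff.differentiable (by simp)) x
  have e : (⇑(a • φ + b • ψ : 𝓓(Ω, ℝ))) = a • (φ : EuclideanSpace ℝ (Fin d) → ℝ) + b • ⇑ψ := rfl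
  simp only [partialDeriv]
  rw [e, fderiv_add (hφ.const_smul a) (hψ.const_smul b), fderiv_const_smul hφ,
    fderiv_const_smul hψ]
  simp

theorem exists_norm_testFunction_le {d : ℕ}
    {Ω : TopologicalSpace.Opens (EuclideanSpace ℝ (Fin d))} (φ : 𝓓(Ω, ℝ)) :
    ∃ S : ℝ, ∀ x, ‖φ x‖ ≤ S :=
  φ.continuous.bounded_above_of_compact_support φ.hasCompactSupport

theorem integrable_testFunction {d : ℕ}
    {Ω : TopologicalSpace.Opens (EuclideanSpace ℝ (Fin d))} (φ : 𝓓(Ω, ℝ)) :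
    Integrable φ volume :=
  φ.continuous.integrable_of_hasCompactSupport φ.hasCompactSupport

theorem MeasureTheory.LocallyIntegrableOn.integrable_mul_testFunction {d : ℕ}
    {Ω : TopologicalSpace.Opens (EuclideanSpace ℝ (Fin d))} {f : EuclideanSpace ℝ (Fin d) → ℝ}
    (hf : LocallyIntegrableOn f Ω) (φ : 𝓓(Ω, ℝ)) :
    Integrable (fun x => f x * φ x) (volume.restrict (Ω : Set (EuclideanSpace ℝ (Fin d)))) := by
  obtain ⟨S, hS⟩ := exists_norm_testFunction_le φ
  have h1 : IntegrableOn f (tsupport φ) :=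
    hf.integrableOn_compact_subset φ.tsupport_subset φ.hasCompactSupport
  have h2 : IntegrableOn (fun x => f x * φ x) (tsupport φ) :=
    Integrable.mul_bdd h1 φ.continuous.aestronglyMeasurable (Eventually.of_forall hS)
  have h3 : Integrable (fun x => f x * φ x) volume := by
    rw [integrableOn_iff_integrable_of_support_subset] at h2
    · exact h2
    · intro x hx
      exact subset_tsupport _ (right_ne_zero_of_mul hx)
  exact h3.restrict

theorem MeasureTheory.LocallyIntegrableOn.lincomb {d : ℕ} {s : Set (EuclideanSpace ℝ (Fin d))}
    {f g : EuclideanSpace ℝ (Fin d) → ℝ} (hf : LocallyIntegrableOn f s)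
    (hg : LocallyIntegrableOn g s) (a b : ℝ) :
    LocallyIntegrableOn (fun x => a * f x + b * g x) s :=
  (hf.smul a).add (hg.smul b)

theorem integral_lincomb_mul_testFunction {d : ℕ}
    {Ω : TopologicalSpace.Opens (EuclideanSpace ℝ (Fin d))} {f g : EuclideanSpace ℝ (Fin d) → ℝ}
    (hf : LocallyIntegrableOn f Ω) (hg : LocallyIntegrableOn g Ω) (a b : ℝ) (φ : 𝓓(Ω, ℝ)) :
    ∫ x in Ω, (a * f x + b * g x) * φ x = a * (∫ x in Ω, f x * φ x) + b * ∫ x in Ω, g x * φ x := by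
  have h1 := LocallyIntegrableOn.integrable_mul_testFunction hf φ
  have h2 := LocallyIntegrableOn.integrable_mul_testFunction hg φ
  rw [← integral_const_mul, ← integral_const_mul,
    ← integral_add (h1.const_mul a) (h2.const_mul b)]
  congr 1; ext x; ring

theorem HasWeakGradient.lincomb {d : ℕ} {Ω : TopologicalSpace.Opens (EuclideanSpace ℝ (Fin d))}
    {u v : EuclideanSpace ℝ (Fin d) → ℝ}
    {G K : EuclideanSpace ℝ (Fin d) → EuclideanSpace ℝ (Fin d)}
    (hu : HasWeakGradient Ω u G) (hv : HasWeakGradient Ω v K) (a b : ℝ) :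
    HasWeakGradient Ω (fun x => a * u x + b * v x) (fun x => a • G x + b • K x) := by
  refine ⟨LocallyIntegrableOn.lincomb hu.1 hv.1 a b,
    fun i => LocallyIntegrableOn.lincomb (hu.2.1 i) (hv.2.1 i) a b, fun φ i => ?_⟩
  have h1 := integral_lincomb_mul_testFunction hu.1 hv.1 a b (partialDerivTest i φ)
  have h2 := integral_lincomb_mul_testFunction (hu.2.1 i) (hv.2.1 i) a b φ
  simp only [coe_partialDerivTest] at h1
  simp only [PiLp.add_apply, PiLp.smul_apply, smul_eq_mul]
  rw [h1, h2, hu.2.2 φ i, hv.2.2 φ i]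
  ring

theorem HasWeakHessian.lincomb {d : ℕ} {Ω : TopologicalSpace.Opens (EuclideanSpace ℝ (Fin d))}
    {u v : EuclideanSpace ℝ (Fin d) → ℝ} {H K : EuclideanSpace ℝ (Fin d) → SymMat d}
    (hu : HasWeakHessian Ω u H) (hv : HasWeakHessian Ω v K) (a b : ℝ) :
    HasWeakHessian Ω (fun x => a * u x + b * v x) (fun x => a • H x + b • K x) := by
  refine ⟨LocallyIntegrableOn.lincomb hu.1 hv.1 a b,
    fun i j => LocallyIntegrableOn.lincomb (hu.2.1 i j) (hv.2.1 i j) a b, fun φ i j => ?_⟩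
  have h1 := integral_lincomb_mul_testFunction hu.1 hv.1 a b
    (partialDerivTest i (partialDerivTest j φ))
  have h2 := integral_lincomb_mul_testFunction (hu.2.1 i j) (hv.2.1 i j) a b φ
  simp only [coe_partialDerivTest] at h1
  rw [h1, hu.2.2 φ i j, hv.2.2 φ i j, ← h2]
  rfl

theorem HasWeakHessian.ae_eq {d : ℕ} {Ω : TopologicalSpace.Opens (EuclideanSpace ℝ (Fin d))}
    {u : EuclideanSpace ℝ (Fin d) → ℝ} {H K : EuclideanSpace ℝ (Fin d) → SymMat d}
    (hH : HasWeakHessian Ω u H) (hK : HasWeakHessian Ω u K) :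
    H =ᵐ[volume.restrict (Ω : Set (EuclideanSpace ℝ (Fin d)))] K := by
  have hij : ∀ i j, ∀ᵐ x ∂(volume.restrict (Ω : Set (EuclideanSpace ℝ (Fin d)))),
      (H x).1 i j = (K x).1 i j := by
    intro i j
    have hd : LocallyIntegrableOn (fun x => (H x).1 i j - (K x).1 i j) Ω :=
      (hH.2.1 i j).sub (hK.2.1 i j)
    have h := Ω.isOpen.ae_eq_zero_of_integral_contDiff_smul_eq_zero hd
      fun ψ hψ hψc hψs => by
        let φ : 𝓓(Ω, ℝ) := ⟨ψ, hψ, hψc, hψs⟩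
        have h1 := hH.2.2 φ i j
        rw [hK.2.2 φ i j] at h1
        have h2 := integral_lincomb_mul_testFunction (hH.2.1 i j) (hK.2.1 i j) 1 (-1) φ
        rw [h1] at h2
        have h3 : ∫ x in Ω, ψ x • ((H x).1 i j - (K x).1 i j) =
            ∫ x, ψ x • ((H x).1 i j - (K x).1 i j) := by
          refine setIntegral_eq_integral_of_forall_compl_eq_zero fun x hx => ?_
          rw [image_eq_zero_of_notMem_tsupport fun h => hx (hψs h), zero_smul]
        rw [← h3]
        have h4 : ∀ x, ψ x • ((H x).1 i j - (K x).1 i j) =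
            (1 * (H x).1 i j + -1 * (K x).1 i j) * φ x := by
          intro x
          change ψ x * _ = _ * ψ x
          ring
        simp only [h4, h2]
        ring
    rw [ae_restrict_iff' Ω.isOpen.measurableSet]
    filter_upwards [h] with x hx hxΩ using sub_eq_zero.1 (hx hxΩ)
  have hall : ∀ᵐ x ∂(volume.restrict (Ω : Set (EuclideanSpace ℝ (Fin d)))),
      ∀ i j, (H x).1 i j = (K x).1 i j := ae_all_iff.2 fun i => ae_all_iff.2 fun j => hij i j
  filter_upwards [hall] with x hx
  exact Subtype.ext (Matrix.ext hx)

theorem hasWeakHessian_weakHessian {d : ℕ}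
    {Ω : TopologicalSpace.Opens (EuclideanSpace ℝ (Fin d))} {u : EuclideanSpace ℝ (Fin d) → ℝ}
    (h : ∃ H, HasWeakHessian Ω u H) : HasWeakHessian Ω u (weakHessian Ω u) := by
  rw [weakHessian, dif_pos h]
  exact h.choose_spec

/-! ### Limits of test functions in `W^{1,p}` of the ball -/

theorem exists_eLpNorm_one_le {α : Type*} [MeasurableSpace α] {μ : Measure α} [IsFiniteMeasure μ]
    {P : ℝ≥0∞} (hP : 1 ≤ P) : ∃ C : ℝ≥0∞, C ≠ ⊤ ∧ ∀ f : α → ℝ, AEStronglyMeasurable f μ →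
      eLpNorm f 1 μ ≤ C * eLpNorm f P μ := by
  refine ⟨μ Set.univ ^ (1 / (1 : ℝ≥0∞).toReal - 1 / P.toReal),
    ENNReal.rpow_ne_top_of_nonneg ?_ (measure_ne_top _ _), fun f hf => ?_⟩
  · rcases eq_or_ne P ⊤ with rfl | hPt
    · simp
    · have h1 : 1 ≤ P.toReal := by
        rw [← ENNReal.toReal_one]; exact ENNReal.toReal_mono hPt hP
      have : 1 / P.toReal ≤ 1 := by rw [div_le_one (by linarith)]; exact h1
      simpa using this
  · rw [mul_comm]
    exact eLpNorm_le_eLpNorm_mul_rpow_measure_univ hP hf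

theorem exists_enorm_integral_mul_le {α : Type*} [MeasurableSpace α] {μ : Measure α}
    [IsFiniteMeasure μ] {P : ℝ≥0∞} (hP : 1 ≤ P) {g : α → ℝ} {S : ℝ} (hS : ∀ x, ‖g x‖ ≤ S) :
    ∃ C : ℝ≥0∞, C ≠ ⊤ ∧ ∀ f : α → ℝ, AEStronglyMeasurable f μ →
      ‖∫ x, f x * g x ∂μ‖ₑ ≤ C * eLpNorm f P μ := by
  obtain ⟨C, hC, hCle⟩ := exists_eLpNorm_one_le (μ := μ) hP
  refine ⟨ENNReal.ofReal S * C, ENNReal.mul_ne_top (by simp) hC, fun f hf => ?_⟩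
  calc ‖∫ x, f x * g x ∂μ‖ₑ ≤ ∫⁻ x, ‖f x * g x‖ₑ ∂μ := enorm_integral_le_lintegral_enorm _
    _ ≤ ∫⁻ x, ENNReal.ofReal S * ‖f x‖ₑ ∂μ := by
        refine lintegral_mono fun x => ?_
        rw [enorm_mul, mul_comm, ← ofReal_norm (g x)]
        exact mul_le_mul_left (ENNReal.ofReal_le_ofReal (hS x)) _
    _ = ENNReal.ofReal S * eLpNorm f 1 μ := by
        rw [lintegral_const_mul' _ _ (by simp), eLpNorm_one_eq_lintegral_enorm]
    _ ≤ _ := by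
        rw [mul_assoc]
        exact mul_le_mul_right (hCle f hf) _

/-- Lebesgue measure on the open unit ball. -/
noncomputable abbrev ballMeasure (d : ℕ) : Measure (EuclideanSpace ℝ (Fin d)) :=
  volume.restrict (unitBall d : Set (EuclideanSpace ℝ (Fin d)))

instance isFiniteMeasure_ballMeasure (d : ℕ) : IsFiniteMeasure (ballMeasure d) :=
  ⟨by
    rw [Measure.restrict_apply MeasurableSet.univ, Set.univ_inter]
    exact measure_ball_lt_top⟩

theorem MeasureTheory.MemLp.locallyIntegrableOn_unitBall {d : ℕ} {P : ℝ≥0∞} (hP : 1 ≤ P)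
    {f : EuclideanSpace ℝ (Fin d) → ℝ} (hf : MemLp f P (ballMeasure d)) :
    LocallyIntegrableOn f (unitBall d : Set (EuclideanSpace ℝ (Fin d))) :=
  IntegrableOn.locallyIntegrableOn (hf.integrable hP)

theorem MeasureTheory.MemLp.memLpLoc_unitBall {d : ℕ} {P : ℝ≥0∞}
    {f : EuclideanSpace ℝ (Fin d) → ℝ} (hf : MemLp f P (ballMeasure d)) :
    MemLpLoc (unitBall d) P f := fun _ _ hK =>
  hf.mono_measure (Measure.restrict_mono hK le_rfl)

/-- `(w, G)` is a limit of pairs `(φ, ∇φ)`, with `φ` a test function on the ball, in `L^p`. -/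
def IsTestLimit {d : ℕ} (P : ℝ≥0∞) (w : EuclideanSpace ℝ (Fin d) → ℝ)
    (G : EuclideanSpace ℝ (Fin d) → EuclideanSpace ℝ (Fin d)) : Prop :=
  ∀ ε : ℝ, 0 < ε → ∃ φ : 𝓓(unitBall d, ℝ),
    eLpNorm (fun x => w x - φ x) P (ballMeasure d) < ENNReal.ofReal ε ∧
    ∀ i, eLpNorm (fun x => G x i - partialDeriv i φ x) P (ballMeasure d) < ENNReal.ofReal ε

theorem aestronglyMeasurable_testFunction {d : ℕ}
    {Ω : TopologicalSpace.Opens (EuclideanSpace ℝ (Fin d))} (φ : 𝓓(Ω, ℝ))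
    (μ : Measure (EuclideanSpace ℝ (Fin d))) : AEStronglyMeasurable φ μ :=
  φ.continuous.aestronglyMeasurable

theorem eLpNorm_lincomb_lt {α : Type*} [MeasurableSpace α] {μ : Measure α} {P : ℝ≥0∞}
    (hP : 1 ≤ P) {f g : α → ℝ} (hf : AEStronglyMeasurable f μ) (hg : AEStronglyMeasurable g μ)
    {a b : ℝ} (ha : |a| ≤ 1) (hb : |b| ≤ 1) {ε : ℝ} (hε : 0 < ε)
    (hfε : eLpNorm f P μ < ENNReal.ofReal (ε / 2))
    (hgε : eLpNorm g P μ < ENNReal.ofReal (ε / 2)) :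
    eLpNorm (fun x => a * f x + b * g x) P μ < ENNReal.ofReal ε := by
  have hle : ∀ (c : ℝ) (h : α → ℝ), |c| ≤ 1 → eLpNorm (fun x => c * h x) P μ ≤ eLpNorm h P μ := by
    intro c h hc
    refine eLpNorm_mono fun x => ?_
    rw [norm_mul, Real.norm_eq_abs]
    exact mul_le_of_le_one_left (norm_nonneg _) hc
  calc eLpNorm (fun x => a * f x + b * g x) P μ
      ≤ eLpNorm (fun x => a * f x) P μ + eLpNorm (fun x => b * g x) P μ :=
        eLpNorm_add_le (hf.const_mul a) (hg.const_mul b) hP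
    _ ≤ eLpNorm f P μ + eLpNorm g P μ := add_le_add (hle a f ha) (hle b g hb)
    _ < ENNReal.ofReal (ε / 2) + ENNReal.ofReal (ε / 2) := ENNReal.add_lt_add hfε hgε
    _ = ENNReal.ofReal ε := by
        rw [← ENNReal.ofReal_add (by positivity) (by positivity), add_halves]

theorem IsTestLimit.lincomb {d : ℕ} {P : ℝ≥0∞} (hP : 1 ≤ P)
    {w w' : EuclideanSpace ℝ (Fin d) → ℝ}
    {G G' : EuclideanSpace ℝ (Fin d) → EuclideanSpace ℝ (Fin d)}
    (h : IsTestLimit P w G) (h' : IsTestLimit P w' G')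
    (hw : AEStronglyMeasurable w (ballMeasure d)) (hw' : AEStronglyMeasurable w' (ballMeasure d))
    (hG : ∀ i, AEStronglyMeasurable (fun x => G x i) (ballMeasure d))
    (hG' : ∀ i, AEStronglyMeasurable (fun x => G' x i) (ballMeasure d))
    {a b : ℝ} (ha : |a| ≤ 1) (hb : |b| ≤ 1) :
    IsTestLimit P (fun x => a * w x + b * w' x) (fun x => a • G x + b • G' x) := by
  intro ε hε
  obtain ⟨φ, h1, h2⟩ := h (ε / 2) (by positivity)
  obtain ⟨φ', h1', h2'⟩ := h' (ε / 2) (by positivity)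
  refine ⟨a • φ + b • φ', ?_, fun i => ?_⟩
  · have := eLpNorm_lincomb_lt hP (hw.sub (aestronglyMeasurable_testFunction φ _))
      (hw'.sub (aestronglyMeasurable_testFunction φ' _)) ha hb hε h1 h1'
    refine lt_of_eq_of_lt (congrArg (eLpNorm · P (ballMeasure d)) (funext fun x => ?_)) this
    change a * w x + b * w' x - (a * φ x + b * φ' x) = a * (w x - φ x) + b * (w' x - φ' x)
    ring
  · have := eLpNorm_lincomb_lt hP
      ((hG i).sub (aestronglyMeasurable_testFunction (partialDerivTest i φ) _))
      ((hG' i).sub (aestronglyMeasurable_testFunction (partialDerivTest i φ') _)) ha hb hε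
      (h2 i) (h2' i)
    refine lt_of_eq_of_lt (congrArg (eLpNorm · P (ballMeasure d)) (funext fun x => ?_)) this
    rw [partialDeriv_lincomb]
    change a * G x i + b * G' x i - _ = a * (G x i - partialDeriv i φ x) +
      b * (G' x i - partialDeriv i φ' x)
    ring

/-- Limits of test functions form a closed set. -/
theorem isTestLimit_of_forall_exists {d : ℕ} {P : ℝ≥0∞} (hP : 1 ≤ P)
    {w : EuclideanSpace ℝ (Fin d) → ℝ}
    {G : EuclideanSpace ℝ (Fin d) → EuclideanSpace ℝ (Fin d)}
    (hw : AEStronglyMeasurable w (ballMeasure d))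
    (hG : ∀ i, AEStronglyMeasurable (fun x => G x i) (ballMeasure d))
    (h : ∀ ε : ℝ, 0 < ε → ∃ (w' : EuclideanSpace ℝ (Fin d) → ℝ)
      (G' : EuclideanSpace ℝ (Fin d) → EuclideanSpace ℝ (Fin d)),
      AEStronglyMeasurable w' (ballMeasure d) ∧
      (∀ i, AEStronglyMeasurable (fun x => G' x i) (ballMeasure d)) ∧ IsTestLimit P w' G' ∧
      eLpNorm (fun x => w x - w' x) P (ballMeasure d) < ENNReal.ofReal ε ∧
      ∀ i, eLpNorm (fun x => G x i - G' x i) P (ballMeasure d) < ENNReal.ofReal ε) :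
    IsTestLimit P w G := by
  intro ε hε
  obtain ⟨w', G', hw', hG', hl, h1, h2⟩ := h (ε / 2) (by positivity)
  obtain ⟨φ, h1', h2'⟩ := hl (ε / 2) (by positivity)
  refine ⟨φ, ?_, fun i => ?_⟩
  · have := eLpNorm_lincomb_lt hP (hw.sub hw')
      (hw'.sub (aestronglyMeasurable_testFunction φ _)) (a := 1) (b := 1) (by simp) (by simp)
      hε h1 h1'
    simpa using this
  · have := eLpNorm_lincomb_lt hP ((hG i).sub (hG' i))
      ((hG' i).sub (aestronglyMeasurable_testFunction (partialDerivTest i φ) _))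
      (a := 1) (b := 1) (by simp) (by simp) hε (h2 i) (h2' i)
    simpa [coe_partialDerivTest] using this

theorem integral_mul_partialDeriv_testFunction {d : ℕ}
    {Ω : TopologicalSpace.Opens (EuclideanSpace ℝ (Fin d))} (φ ψ : 𝓓(Ω, ℝ)) (i : Fin d) :
    ∫ x in Ω, φ x * partialDeriv i ψ x = - ∫ x in Ω, partialDeriv i φ x * ψ x := by
  have hz : ∀ (f : EuclideanSpace ℝ (Fin d) → ℝ) (χ : 𝓓(Ω, ℝ)),
      ∫ x in Ω, f x * χ x = ∫ x, f x * χ x := fun f χ =>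
    setIntegral_eq_integral_of_forall_compl_eq_zero fun x hx => by
      rw [image_eq_zero_of_notMem_tsupport fun h => hx (χ.tsupport_subset h), mul_zero]
  have hi : ∀ χ χ' : 𝓓(Ω, ℝ), Integrable (fun x => χ x * χ' x) volume := fun χ χ' => by
    obtain ⟨S, hS⟩ := exists_norm_testFunction_le χ'
    exact (integrable_testFunction χ).mul_bdd χ'.continuous.aestronglyMeasurable
      (Eventually.of_forall hS)
  have h1 := hz φ (partialDerivTest i ψ)
  simp only [coe_partialDerivTest] at h1
  rw [h1, hz]
  exact integral_mul_fderiv_eq_neg_fderiv_mul_of_integrable (hi (partialDerivTest i φ) ψ)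
    (hi φ (partialDerivTest i ψ)) (hi φ ψ) (fun x _ => (φ.contDiff.differentiable (by simp)) x)
    (fun x _ => (ψ.contDiff.differentiable (by simp)) x)

theorem IsTestLimit.hasWeakGradient {d : ℕ} {P : ℝ≥0∞} (hP : 1 ≤ P)
    {w : EuclideanSpace ℝ (Fin d) → ℝ}
    {G : EuclideanSpace ℝ (Fin d) → EuclideanSpace ℝ (Fin d)}
    (h : IsTestLimit P w G) (hw : MemLp w P (ballMeasure d))
    (hG : ∀ i, MemLp (fun x => G x i) P (ballMeasure d)) : HasWeakGradient (unitBall d) w G := by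
  refine ⟨hw.locallyIntegrableOn_unitBall hP, fun i => (hG i).locallyIntegrableOn_unitBall hP,
    fun φ i => ?_⟩
  obtain ⟨S, hS⟩ := exists_norm_testFunction_le φ
  obtain ⟨S', hS'⟩ := exists_norm_testFunction_le (partialDerivTest i φ)
  obtain ⟨C, hC, hCle⟩ := exists_enorm_integral_mul_le (μ := ballMeasure d) hP hS
  obtain ⟨C', hC', hCle'⟩ := exists_enorm_integral_mul_le (μ := ballMeasure d) hP hS'
  have hz : ‖(∫ x in unitBall d, w x * partialDeriv i φ x) +
      ∫ x in unitBall d, G x i * φ x‖ₑ = 0 := by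
    refine nonpos_iff_eq_zero.1 (ge_of_tendsto' (f := fun n : ℕ =>
      (C' + C) * ENNReal.ofReal (1 / ((n : ℝ) + 1))) (x := atTop) ?_ fun n => ?_)
    · have := (ENNReal.tendsto_ofReal (tendsto_one_div_add_atTop_nhds_zero_nat (𝕜 := ℝ)))
      have := ENNReal.Tendsto.const_mul (a := C' + C) this
        (Or.inr (ENNReal.add_ne_top.2 ⟨hC', hC⟩))
      simpa using this
    · obtain ⟨ψ, h1, h2⟩ := h (1 / ((n : ℝ) + 1)) (by positivity)
      have hwi := LocallyIntegrableOn.integrable_mul_testFunction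
        (hw.locallyIntegrableOn_unitBall hP) (partialDerivTest i φ)
      have hψi := LocallyIntegrableOn.integrable_mul_testFunction
        ((integrable_testFunction ψ).locallyIntegrable.locallyIntegrableOn (unitBall d : Set _))
        (partialDerivTest i φ)
      have hGi := LocallyIntegrableOn.integrable_mul_testFunction
        ((hG i).locallyIntegrableOn_unitBall hP) φ
      have hψi' := LocallyIntegrableOn.integrable_mul_testFunction
        ((integrable_testFunction (partialDerivTest i ψ)).locallyIntegrable.locallyIntegrableOn
          (unitBall d : Set _)) φ
      have e1 : (∫ x in unitBall d, w x * partialDeriv i φ x) + ∫ x in unitBall d, G x i * φ x =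
          (∫ x in unitBall d, (w x - ψ x) * partialDerivTest i φ x) +
            ∫ x in unitBall d, (G x i - partialDerivTest i ψ x) * φ x := by
        simp only [sub_mul]
        rw [integral_sub hwi hψi, integral_sub hGi hψi']
        simp only [coe_partialDerivTest]
        rw [integral_mul_partialDeriv_testFunction]
        ring
      rw [e1]
      refine (enorm_add_le _ _).trans ?_
      rw [add_mul]
      refine add_le_add ((hCle' _ (hw.1.sub (aestronglyMeasurable_testFunction ψ _))).trans
        (mul_le_mul_right h1.le _)) ((hCle _ ((hG i).1.sub
        (aestronglyMeasurable_testFunction (partialDerivTest i ψ) _))).trans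
        (mul_le_mul_right (h2 i).le _))
  rw [enorm_eq_zero] at hz
  linarith

theorem IsTestLimit.memW1pZero {d : ℕ} {P : ℝ≥0∞} (hP : 1 ≤ P)
    {w : EuclideanSpace ℝ (Fin d) → ℝ}
    {G : EuclideanSpace ℝ (Fin d) → EuclideanSpace ℝ (Fin d)}
    (h : IsTestLimit P w G) (hw : MemLp w P (ballMeasure d))
    (hG : ∀ i, MemLp (fun x => G x i) P (ballMeasure d)) : MemW1pZero (unitBall d) P w :=
  ⟨hw, G, h.hasWeakGradient hP hw hG, hG, h⟩

/-! ### A priori estimates with zero boundary values -/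

theorem norm_single_one_eq_one {d : ℕ} (i : Fin d) :
    ‖(EuclideanSpace.single i 1 : EuclideanSpace ℝ (Fin d))‖ = 1 := by simp

/-- A first derivative of a function vanishing on the boundary of the ball is controlled by the
second derivative in the same direction. -/
theorem IsTestLimit.eLpNorm_gradient_le {d : ℕ} {p : ℝ} (hp : 1 ≤ p)
    {w : EuclideanSpace ℝ (Fin d) → ℝ}
    {G : EuclideanSpace ℝ (Fin d) → EuclideanSpace ℝ (Fin d)}
    {H : EuclideanSpace ℝ (Fin d) → SymMat d}
    (h : IsTestLimit (ENNReal.ofReal p) w G) (hw : MemLp w (ENNReal.ofReal p) (ballMeasure d))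
    (hG : ∀ i, MemLp (fun x => G x i) (ENNReal.ofReal p) (ballMeasure d))
    (hH : HasWeakHessian (unitBall d) w H) (i : Fin d)
    (hHi : MemLp (fun x => (H x).1 i i) (ENNReal.ofReal p) (ballMeasure d)) :
    eLpNorm (fun x => G x i) (ENNReal.ofReal p) (ballMeasure d) ≤
      4 * eLpNorm (fun x => (H x).1 i i) (ENNReal.ofReal p) (ballMeasure d) := by
  have hP : 1 ≤ ENNReal.ofReal p := by simpa using ENNReal.ofReal_le_ofReal hp
  let B : Set (EuclideanSpace ℝ (Fin d)) := Metric.ball 0 1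
  have hB : MeasurableSet B := measurableSet_ball
  -- extension by zero of everywhere measurable representatives
  let v : EuclideanSpace ℝ (Fin d) → ℝ := B.indicator ((hG i).1.mk _)
  let f : EuclideanSpace ℝ (Fin d) → ℝ := B.indicator (hHi.1.mk _)
  have hvG : v =ᵐ[ballMeasure d] fun x => G x i := by
    filter_upwards [(hG i).1.ae_eq_mk, ae_restrict_mem hB] with x hx hxB
    rw [hx]; exact Set.indicator_of_mem hxB _
  have hfH : f =ᵐ[ballMeasure d] fun x => (H x).1 i i := by
    filter_upwards [hHi.1.ae_eq_mk, ae_restrict_mem hB] with x hx hxB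
    rw [hx]; exact Set.indicator_of_mem hxB _
  have hv0 : ∀ x, x ∉ B → v x = 0 := fun x hx => Set.indicator_of_notMem hx _
  have hf0 : ∀ x, x ∉ B → f x = 0 := fun x hx => Set.indicator_of_notMem hx _
  have hvm : Measurable v := (hG i).1.stronglyMeasurable_mk.measurable.indicator hB
  have hfm : Measurable f := hHi.1.stronglyMeasurable_mk.measurable.indicator hB
  have hint : ∀ g g' : EuclideanSpace ℝ (Fin d) → ℝ, (∀ x, x ∉ B → g x = 0) →
      g =ᵐ[ballMeasure d] g' → MemLp g' (ENNReal.ofReal p) (ballMeasure d) →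
      Integrable g volume := by
    intro g g' hg0 hgg hg'
    refine (integrableOn_iff_integrable_of_support_subset fun x hx => ?_).1
      ((hg'.integrable hP).congr hgg.symm)
    by_contra hxB
    exact hx (hg0 x hxB)
  have hmul : ∀ g g' k : EuclideanSpace ℝ (Fin d) → ℝ, (∀ x, x ∉ B → g x = 0) →
      g =ᵐ[ballMeasure d] g' → ∫ x, g x * k x = ∫ x in unitBall d, g' x * k x := by
    intro g g' k hg0 hgg
    rw [← setIntegral_eq_integral_of_forall_compl_eq_zero (s := B)
      fun x hx => by rw [hg0 x hx, zero_mul]]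
    refine integral_congr_ae ?_
    filter_upwards [hgg] with x hx
    rw [hx]
  have hwk := h.hasWeakGradient hP hw hG
  have hline := ae_enorm_le_lintegral_line_of_weak_deriv volume (hint v _ hv0 hvG (hG i)) hvm hv0
    (hint f _ hf0 hfH hHi) hfm (norm_single_one_eq_one i) (fun ψ hψ hψc hψs => by
      let φ : 𝓓(unitBall d, ℝ) := ⟨ψ, hψ, hψc, hψs⟩
      have h1 := hwk.2.2 (partialDerivTest i φ) i
      have h2 := hH.2.2 φ i i
      simp only [coe_partialDerivTest] at h1
      rw [h2] at h1
      rw [hmul v _ _ hv0 hvG, hmul f _ _ hf0 hfH]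
      exact (neg_eq_iff_eq_neg.2 h1).symm) (fun ε hε => by
      obtain ⟨C, hC, hCle⟩ := exists_eLpNorm_one_le (μ := ballMeasure d) hP
      obtain ⟨δ, hδ, hδε⟩ := ENNReal.exists_pos_mul_ofReal_lt hC hε
      obtain ⟨φ, -, h2⟩ := h δ hδ
      refine ⟨φ, φ.contDiff, φ.hasCompactSupport, φ.tsupport_subset, ?_⟩
      have hz : ∀ x, x ∉ B → partialDeriv i φ x = 0 := fun x hx =>
        image_eq_zero_of_notMem_tsupport fun h => hx ((partialDerivTest i φ).tsupport_subset h)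
      calc ∫⁻ x, ‖v x - fderiv ℝ φ x (EuclideanSpace.single i 1)‖ₑ
          = ∫⁻ x in B, ‖v x - partialDeriv i φ x‖ₑ := by
            rw [← lintegral_indicator hB]
            refine lintegral_congr fun x => ?_
            by_cases hx : x ∈ B
            · rw [Set.indicator_of_mem hx]; rfl
            · rw [Set.indicator_of_notMem hx, hv0 x hx]
              have := hz x hx
              rw [partialDeriv] at this
              rw [this]; simp
        _ = eLpNorm (fun x => G x i - partialDeriv i φ x) 1 (ballMeasure d) := by
            rw [eLpNorm_one_eq_lintegral_enorm]
            refine lintegral_congr_ae ?_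
            filter_upwards [hvG] with x hx
            rw [hx]
        _ ≤ C * eLpNorm (fun x => G x i - partialDeriv i φ x) (ENNReal.ofReal p)
              (ballMeasure d) :=
            hCle _ ((hG i).1.sub (aestronglyMeasurable_testFunction (partialDerivTest i φ) _))
        _ ≤ C * ENNReal.ofReal δ := mul_le_mul_right (h2 i).le _
        _ ≤ ε := hδε.le)
  have := eLpNorm_le_of_enorm_le_line volume hfm hf0 (norm_single_one_eq_one i) hp hline
  rw [← eLpNorm_congr_ae hvG, ← eLpNorm_congr_ae hfH]
  exact this

theorem eLpNorm_testFunction_le {d : ℕ} {p : ℝ} (hp : 1 ≤ p) (φ : 𝓓(unitBall d, ℝ)) (i : Fin d) :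
    eLpNorm φ (ENNReal.ofReal p) (ballMeasure d) ≤
      4 * eLpNorm (partialDeriv i φ) (ENNReal.ofReal p) (ballMeasure d) := by
  refine eLpNorm_le_of_enorm_le_line volume (partialDerivTest i φ).continuous.measurable
    (fun x hx => image_eq_zero_of_notMem_tsupport fun h =>
      hx ((partialDerivTest i φ).tsupport_subset h)) (norm_single_one_eq_one i) hp
    (Eventually.of_forall fun x => ?_)
  exact enorm_le_lintegral_line_fderiv (φ.contDiff.of_le (by exact_mod_cast le_top))
    φ.hasCompactSupport (fun h => by simpa [h] using norm_single_one_eq_one i) x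

/-- Poincaré's inequality for limits of test functions. -/
theorem IsTestLimit.eLpNorm_le {d : ℕ} {p : ℝ} (hp : 1 ≤ p)
    {w : EuclideanSpace ℝ (Fin d) → ℝ}
    {G : EuclideanSpace ℝ (Fin d) → EuclideanSpace ℝ (Fin d)}
    (h : IsTestLimit (ENNReal.ofReal p) w G)
    (hw : AEStronglyMeasurable w (ballMeasure d))
    (hG : ∀ i, AEStronglyMeasurable (fun x => G x i) (ballMeasure d)) (i : Fin d) :
    eLpNorm w (ENNReal.ofReal p) (ballMeasure d) ≤
      4 * eLpNorm (fun x => G x i) (ENNReal.ofReal p) (ballMeasure d) := by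
  have hP : 1 ≤ ENNReal.ofReal p := by simpa using ENNReal.ofReal_le_ofReal hp
  refine le_of_forall_pos_le_add fun ε hε => ?_
  obtain ⟨δ, hδ, hδε⟩ := ENNReal.exists_pos_mul_ofReal_lt (K := 5) (by simp) hε.ne'
  obtain ⟨φ, h1, h2⟩ := h δ hδ
  have hφm := aestronglyMeasurable_testFunction φ (ballMeasure d)
  have hdm := aestronglyMeasurable_testFunction (partialDerivTest i φ) (ballMeasure d)
  have e1 : eLpNorm w (ENNReal.ofReal p) (ballMeasure d) ≤
      ENNReal.ofReal δ + eLpNorm φ (ENNReal.ofReal p) (ballMeasure d) := by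
    have := eLpNorm_add_le (hw.sub hφm) hφm hP
    simp only [sub_add_cancel] at this
    exact this.trans (add_le_add_left h1.le _)
  have e2 : eLpNorm (partialDeriv i φ) (ENNReal.ofReal p) (ballMeasure d) ≤
      eLpNorm (fun x => G x i) (ENNReal.ofReal p) (ballMeasure d) + ENNReal.ofReal δ := by
    have := eLpNorm_sub_le (hG i) ((hG i).sub hdm) hP
    have e3 : (fun x => G x i) - ((fun x => G x i) - ⇑(partialDerivTest i φ)) =
        partialDeriv i φ := by
      rw [sub_sub_cancel]; rfl
    rw [e3] at this
    exact this.trans (add_le_add_right (h2 i).le _)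
  calc eLpNorm w (ENNReal.ofReal p) (ballMeasure d)
      ≤ ENNReal.ofReal δ + 4 * (eLpNorm (fun x => G x i) (ENNReal.ofReal p) (ballMeasure d) +
          ENNReal.ofReal δ) :=
        e1.trans (add_le_add_right ((eLpNorm_testFunction_le hp φ i).trans
          (mul_le_mul_right e2 _)) _)
    _ = 4 * eLpNorm (fun x => G x i) (ENNReal.ofReal p) (ballMeasure d) +
          5 * ENNReal.ofReal δ := by ring
    _ ≤ _ := add_le_add_right hδε.le _

/-! ### Closed convex sets of jets -/

/-- The space of values `(w, ∇w, D²w)`; the second derivatives are recorded as an arbitrary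
matrix, to be symmetrized by `jetHessian`. -/
abbrev Jet (d : ℕ) : Type := EuclideanSpace ℝ (Option (Fin d) ⊕ Fin d × Fin d)

/-- The value component of a jet. -/
def jetValue {d : ℕ} (j : Jet d) : ℝ := j (Sum.inl none)

/-- The gradient component of a jet. -/
def jetGradient {d : ℕ} (j : Jet d) : EuclideanSpace ℝ (Fin d) :=
  WithLp.toLp 2 fun i => j (Sum.inl (some i))

/-- The symmetric part of the second-order component of a jet. -/
noncomputable def jetHessian {d : ℕ} : Jet d →ₗ[ℝ] SymMat d where
  toFun j := ⟨Matrix.of fun i k => (j (Sum.inr (i, k)) + j (Sum.inr (k, i))) / 2, by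
    change Matrix.IsSymm _
    ext i k
    simp [add_comm]⟩
  map_add' j j' := by
    ext i k
    simp only [PiLp.add_apply, Submodule.coe_add, Matrix.add_apply, Matrix.of_apply]
    ring
  map_smul' c j := by
    ext i k
    simp only [PiLp.smul_apply, smul_eq_mul, RingHom.id_apply, Submodule.coe_smul,
      Matrix.smul_apply, Matrix.of_apply]
    ring

/-- The jet with given components. -/
def mkJet {d : ℕ} (w : ℝ) (G : EuclideanSpace ℝ (Fin d)) (H : SymMat d) : Jet d :=
  WithLp.toLp 2 (Sum.elim (fun o => o.elim w fun i => G i) fun ik => H.1 ik.1 ik.2)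

theorem jetHessian_apply {d : ℕ} (j : Jet d) (i k : Fin d) :
    (jetHessian j).1 i k = (j (Sum.inr (i, k)) + j (Sum.inr (k, i))) / 2 := rfl

theorem jetHessian_mkJet {d : ℕ} (w : ℝ) (G : EuclideanSpace ℝ (Fin d)) (H : SymMat d) :
    jetHessian (mkJet w G H) = H := by
  ext i k
  have h : H.1 k i = H.1 i k := Matrix.IsSymm.apply H.2 i k
  rw [jetHessian_apply]
  change (H.1 i k + H.1 k i) / 2 = H.1 i k
  rw [h]; ring

theorem continuous_jetHessian {d : ℕ} : Continuous (jetHessian (d := d)) :=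
  LinearMap.continuous_of_finiteDimensional _

theorem jetValue_lincomb {d : ℕ} (a b : ℝ) (j j' : Jet d) :
    jetValue (a • j + b • j') = a * jetValue j + b * jetValue j' := rfl

theorem jetGradient_lincomb {d : ℕ} (a b : ℝ) (j j' : Jet d) :
    jetGradient (a • j + b • j') = a • jetGradient j + b • jetGradient j' := rfl

theorem eLpNorm_jet_apply_le {d : ℕ} {α : Type*} [MeasurableSpace α] {μ : Measure α} (P : ℝ≥0∞)
    (f : α → Jet d) (k : Option (Fin d) ⊕ Fin d × Fin d) :
    eLpNorm (fun x => f x k) P μ ≤ eLpNorm f P μ :=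
  eLpNorm_mono fun x => PiLp.norm_apply_le (f x) k

theorem MeasureTheory.Lp.memLp_jet_apply {d : ℕ} {P : ℝ≥0∞} (j : Lp (Jet d) P (ballMeasure d))
    (k : Option (Fin d) ⊕ Fin d × Fin d) : MemLp (fun x => j x k) P (ballMeasure d) :=
  (Lp.memLp j).eval_piLp k

theorem MeasureTheory.Lp.memLp_jetValue {d : ℕ} {P : ℝ≥0∞} (j : Lp (Jet d) P (ballMeasure d)) :
    MemLp (fun x => jetValue (j x)) P (ballMeasure d) :=
  Lp.memLp_jet_apply j _

theorem MeasureTheory.Lp.memLp_jetGradient {d : ℕ} {P : ℝ≥0∞} (j : Lp (Jet d) P (ballMeasure d))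
    (i : Fin d) :
    MemLp (fun x => jetGradient (j x) i) P (ballMeasure d) :=
  Lp.memLp_jet_apply j _

theorem MeasureTheory.Lp.memLp_jetHessian {d : ℕ} {P : ℝ≥0∞} (j : Lp (Jet d) P (ballMeasure d))
    (i k : Fin d) : MemLp (fun x => (jetHessian (j x)).1 i k) P (ballMeasure d) := by
  have := ((Lp.memLp_jet_apply j (Sum.inr (i, k))).add
    (Lp.memLp_jet_apply j (Sum.inr (k, i)))).const_mul (1 / 2 : ℝ)
  refine this.ae_eq (Eventually.of_forall fun x => ?_)
  change (1 / 2 : ℝ) * (j x (Sum.inr (i, k)) + j x (Sum.inr (k, i))) =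
    (j x (Sum.inr (i, k)) + j x (Sum.inr (k, i))) / 2
  ring

theorem MeasureTheory.Lp.eLpNorm_jet_sub_apply_le {d : ℕ} {P : ℝ≥0∞} [Fact (1 ≤ P)]
    (j j' : Lp (Jet d) P (ballMeasure d)) (k : Option (Fin d) ⊕ Fin d × Fin d) :
    eLpNorm (fun x => j x k - j' x k) P (ballMeasure d) ≤ ENNReal.ofReal (dist j j') := by
  rw [← edist_dist, Lp.edist_def]
  exact eLpNorm_jet_apply_le P (⇑j - ⇑j') k

theorem MeasureTheory.Lp.eLpNorm_jetHessian_sub_le {d : ℕ} {P : ℝ≥0∞} [hP : Fact (1 ≤ P)]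
    (j j' : Lp (Jet d) P (ballMeasure d)) (i k : Fin d) :
    eLpNorm (fun x => (jetHessian (j x)).1 i k - (jetHessian (j' x)).1 i k) P (ballMeasure d) ≤
      ENNReal.ofReal (dist j j') := by
  rw [← edist_dist, Lp.edist_def]
  refine eLpNorm_mono fun x => ?_
  have h1 := PiLp.norm_apply_le ((⇑j - ⇑j') x) (Sum.inr (i, k))
  have h2 := PiLp.norm_apply_le ((⇑j - ⇑j') x) (Sum.inr (k, i))
  have e : (jetHessian (j x)).1 i k - (jetHessian (j' x)).1 i k =
      (((⇑j - ⇑j') x) (Sum.inr (i, k)) + ((⇑j - ⇑j') x) (Sum.inr (k, i))) / 2 := by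
    rw [jetHessian_apply, jetHessian_apply]
    simp only [Pi.sub_apply, PiLp.sub_apply]
    ring
  rw [e, norm_div, Real.norm_of_nonneg (by norm_num : (0 : ℝ) ≤ 2), div_le_iff₀ (by norm_num)]
  exact (norm_add_le _ _).trans (by linarith)

theorem MeasureTheory.Lp.coeFn_lincomb {α V : Type*} [MeasurableSpace α] {μ : Measure α}
    [NormedAddCommGroup V] [NormedSpace ℝ V] {P : ℝ≥0∞} (a b : ℝ) (j j' : Lp V P μ) :
    ⇑(a • j + b • j') =ᵐ[μ] fun x => a • j x + b • j' x := by
  filter_upwards [Lp.coeFn_add (a • j) (b • j'), Lp.coeFn_smul a j, Lp.coeFn_smul b j']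
    with x h1 h2 h3
  rw [h1, Pi.add_apply, h2, h3]; rfl

/-- The `L^p` jets `(w, ∇w, D²w)` of functions `w` in `W^{2,p} ∩ W^{1,p}_0` of the ball. -/
def zeroBoundaryJets (d : ℕ) (P : ℝ≥0∞) : Set (Lp (Jet d) P (ballMeasure d)) :=
  {j | IsTestLimit P (fun x => jetValue (j x)) (fun x => jetGradient (j x)) ∧
    ∀ (φ : 𝓓(unitBall d, ℝ)) (i k : Fin d),
      ∫ x in unitBall d, jetValue (j x) * partialDeriv i (partialDeriv k φ) x =
        ∫ x in unitBall d, (jetHessian (j x)).1 i k * φ x}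

theorem IsTestLimit.congr_ae {d : ℕ} {P : ℝ≥0∞} {w w' : EuclideanSpace ℝ (Fin d) → ℝ}
    {G G' : EuclideanSpace ℝ (Fin d) → EuclideanSpace ℝ (Fin d)} (h : IsTestLimit P w G)
    (hw : w =ᵐ[ballMeasure d] w') (hG : G =ᵐ[ballMeasure d] G') : IsTestLimit P w' G' := by
  intro ε hε
  obtain ⟨φ, h1, h2⟩ := h ε hε
  refine ⟨φ, lt_of_eq_of_lt (eLpNorm_congr_ae ?_) h1,
    fun i => lt_of_eq_of_lt (eLpNorm_congr_ae ?_) (h2 i)⟩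
  · filter_upwards [hw] with x hx; rw [hx]
  · filter_upwards [hG] with x hx; rw [hx]

theorem hasWeakHessian_of_mem_zeroBoundaryJets {d : ℕ} {P : ℝ≥0∞} (hP : 1 ≤ P)
    {j : Lp (Jet d) P (ballMeasure d)} (hj : j ∈ zeroBoundaryJets d P) :
    HasWeakHessian (unitBall d) (fun x => jetValue (j x)) (fun x => jetHessian (j x)) :=
  ⟨(Lp.memLp_jetValue j).locallyIntegrableOn_unitBall hP,
    fun i k => (Lp.memLp_jetHessian j i k).locallyIntegrableOn_unitBall hP, hj.2⟩

theorem convex_zeroBoundaryJets {d : ℕ} {P : ℝ≥0∞} (hP : 1 ≤ P) :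
    Convex ℝ (zeroBoundaryJets d P) := by
  intro j hj j' hj' a b ha hb hab
  have hcoe := Lp.coeFn_lincomb a b j j'
  constructor
  · have h := hj.1.lincomb hP hj'.1 (Lp.memLp_jetValue j).1 (Lp.memLp_jetValue j').1
      (fun i => (Lp.memLp_jetGradient j i).1) (fun i => (Lp.memLp_jetGradient j' i).1)
      (a := a) (b := b) (by rw [abs_of_nonneg ha]; linarith) (by rw [abs_of_nonneg hb]; linarith)
    refine h.congr_ae ?_ ?_
    · filter_upwards [hcoe] with x hx
      rw [hx, jetValue_lincomb]
    · filter_upwards [hcoe] with x hx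
      rw [hx, jetGradient_lincomb]
  · intro φ i k
    have h := ((hasWeakHessian_of_mem_zeroBoundaryJets hP hj).lincomb
      (hasWeakHessian_of_mem_zeroBoundaryJets hP hj') a b).2.2 φ i k
    calc _ = _ := by
          refine integral_congr_ae ?_
          filter_upwards [hcoe] with x hx
          rw [hx, jetValue_lincomb]
      _ = _ := h
      _ = _ := by
          refine integral_congr_ae ?_
          filter_upwards [hcoe] with x hx
          rw [hx, map_add, map_smul, map_smul]

theorem isClosed_zeroBoundaryJets {d : ℕ} {P : ℝ≥0∞} [hP : Fact (1 ≤ P)] :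
    IsClosed (zeroBoundaryJets d P) := by
  refine isClosed_of_closure_subset fun j hj => ?_
  rw [Metric.mem_closure_iff] at hj
  constructor
  · refine isTestLimit_of_forall_exists hP.out (Lp.memLp_jetValue j).1
      (fun i => (Lp.memLp_jetGradient j i).1) fun ε hε => ?_
    obtain ⟨j', hj', hd⟩ := hj ε hε
    have hlt : ENNReal.ofReal (dist j j') < ENNReal.ofReal ε :=
      (ENNReal.ofReal_lt_ofReal_iff hε).2 hd
    exact ⟨_, _, (Lp.memLp_jetValue j').1, fun i => (Lp.memLp_jetGradient j' i).1, hj'.1,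
      (Lp.eLpNorm_jet_sub_apply_le j j' _).trans_lt hlt,
      fun i => (Lp.eLpNorm_jet_sub_apply_le j j' _).trans_lt hlt⟩
  · intro φ i k
    let χ : 𝓓(unitBall d, ℝ) := partialDerivTest i (partialDerivTest k φ)
    obtain ⟨S, hS⟩ := exists_norm_testFunction_le φ
    obtain ⟨S', hS'⟩ := exists_norm_testFunction_le χ
    obtain ⟨C, hC, hCle⟩ := exists_enorm_integral_mul_le (μ := ballMeasure d) hP.out hS
    obtain ⟨C', hC', hCle'⟩ := exists_enorm_integral_mul_le (μ := ballMeasure d) hP.out hS'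
    have hz : ‖(∫ x in unitBall d, jetValue (j x) * χ x) -
        ∫ x in unitBall d, (jetHessian (j x)).1 i k * φ x‖ₑ = 0 := by
      refine nonpos_iff_eq_zero.1 (le_of_forall_pos_le_add fun ε hε => ?_)
      obtain ⟨δ, hδ, hδε⟩ := ENNReal.exists_pos_mul_ofReal_lt
        (ENNReal.add_ne_top.2 ⟨hC', hC⟩) hε.ne'
      obtain ⟨j', hj', hd⟩ := hj δ hδ
      have hle : ENNReal.ofReal (dist j j') ≤ ENNReal.ofReal δ := ENNReal.ofReal_le_ofReal hd.le
      have i1 := LocallyIntegrableOn.integrable_mul_testFunction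
        ((Lp.memLp_jetValue j).locallyIntegrableOn_unitBall hP.out) χ
      have i2 := LocallyIntegrableOn.integrable_mul_testFunction
        ((Lp.memLp_jetValue j').locallyIntegrableOn_unitBall hP.out) χ
      have i3 := LocallyIntegrableOn.integrable_mul_testFunction
        ((Lp.memLp_jetHessian j i k).locallyIntegrableOn_unitBall hP.out) φ
      have i4 := LocallyIntegrableOn.integrable_mul_testFunction
        ((Lp.memLp_jetHessian j' i k).locallyIntegrableOn_unitBall hP.out) φ
      have e1 : (∫ x in unitBall d, jetValue (j x) * χ x) -
          ∫ x in unitBall d, (jetHessian (j x)).1 i k * φ x =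
          (∫ x in unitBall d, (jetValue (j x) - jetValue (j' x)) * χ x) -
            ∫ x in unitBall d, ((jetHessian (j x)).1 i k - (jetHessian (j' x)).1 i k) * φ x := by
        simp only [sub_mul]
        rw [integral_sub i1 i2, integral_sub i3 i4]
        have h0 : ∫ x in unitBall d, jetValue (j' x) * χ x =
          ∫ x in unitBall d, (jetHessian (j' x)).1 i k * φ x := hj'.2 φ i k
        rw [h0]; ring
      rw [e1, zero_add]
      refine (enorm_sub_le).trans (le_trans ?_ hδε.le)
      rw [add_mul]
      exact add_le_add
        ((hCle' _ ((Lp.memLp_jetValue j).1.sub (Lp.memLp_jetValue j').1)).trans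
          (mul_le_mul_right ((Lp.eLpNorm_jet_sub_apply_le j j' _).trans hle) _))
        ((hCle _ ((Lp.memLp_jetHessian j i k).1.sub (Lp.memLp_jetHessian j' i k).1)).trans
          (mul_le_mul_right ((Lp.eLpNorm_jetHessian_sub_le j j' i k).trans hle) _))
    rw [enorm_eq_zero] at hz
    exact sub_eq_zero.1 hz

/-- The jets `j` for which the energy of `H₀ + D²w` is at most `M`. -/
def energySublevel {d : ℕ} (F : SymMat d → ℝ) (p : ℝ)
    (H₀ : EuclideanSpace ℝ (Fin d) → SymMat d) (P M : ℝ≥0∞) :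
    Set (Lp (Jet d) P (ballMeasure d)) :=
  {j | ∫⁻ x in unitBall d, ENNReal.ofReal (F (H₀ x + jetHessian (j x)) ^ p) ≤ M}

theorem aemeasurable_energy {d : ℕ} {F : SymMat d → ℝ} (hF : Continuous F) {p : ℝ} (hp : 0 ≤ p)
    {H₀ : EuclideanSpace ℝ (Fin d) → SymMat d} (hH₀ : AEStronglyMeasurable H₀ (ballMeasure d))
    {P : ℝ≥0∞} (j : Lp (Jet d) P (ballMeasure d)) :
    AEMeasurable (fun x => ENNReal.ofReal (F (H₀ x + jetHessian (j x)) ^ p)) (ballMeasure d) := by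
  have h1 : AEStronglyMeasurable (fun x => H₀ x + jetHessian (j x)) (ballMeasure d) :=
    hH₀.add (continuous_jetHessian.comp_aestronglyMeasurable (Lp.aestronglyMeasurable j))
  have h2 : Continuous fun M : SymMat d => F M ^ p := (Real.continuous_rpow_const hp).comp hF
  exact (h2.comp_aestronglyMeasurable h1).aemeasurable.ennreal_ofReal

theorem convex_energySublevel {d : ℕ} {F : SymMat d → ℝ} (hF : ConvexOn ℝ Set.univ F)
    (hFc : Continuous F) (hF0 : ∀ M, 0 ≤ F M) {p : ℝ} (hp : 1 ≤ p)
    {H₀ : EuclideanSpace ℝ (Fin d) → SymMat d} (hH₀ : AEStronglyMeasurable H₀ (ballMeasure d))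
    (P M : ℝ≥0∞) : Convex ℝ (energySublevel F p H₀ P M) := by
  intro j hj j' hj' a b ha hb hab
  have hp0 : 0 ≤ p := by linarith
  have hm := aemeasurable_energy hFc hp0 hH₀ j
  calc ∫⁻ x in unitBall d,
        ENNReal.ofReal (F (H₀ x + jetHessian ((a • j + b • j' : Lp (Jet d) P _) x)) ^ p)
      ≤ ∫⁻ x in unitBall d, (ENNReal.ofReal a *
            ENNReal.ofReal (F (H₀ x + jetHessian (j x)) ^ p) +
          ENNReal.ofReal b * ENNReal.ofReal (F (H₀ x + jetHessian (j' x)) ^ p)) := by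
        refine lintegral_mono_ae ?_
        filter_upwards [Lp.coeFn_lincomb a b j j'] with x hx
        rw [hx, map_add, map_smul, map_smul]
        have e1 : H₀ x + (a • jetHessian (j x) + b • jetHessian (j' x)) =
            a • (H₀ x + jetHessian (j x)) + b • (H₀ x + jetHessian (j' x)) := by
          have : H₀ x = a • H₀ x + b • H₀ x := by rw [← add_smul, hab, one_smul]
          nth_rewrite 1 [this]
          module
        rw [e1, ← ENNReal.ofReal_mul ha, ← ENNReal.ofReal_mul hb,
          ← ENNReal.ofReal_add (mul_nonneg ha (Real.rpow_nonneg (hF0 _) _))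
            (mul_nonneg hb (Real.rpow_nonneg (hF0 _) _))]
        refine ENNReal.ofReal_le_ofReal ?_
        have h1 := hF.2 (Set.mem_univ (H₀ x + jetHessian (j x)))
          (Set.mem_univ (H₀ x + jetHessian (j' x))) ha hb hab
        have h2 := (convexOn_rpow hp).2 (hF0 (H₀ x + jetHessian (j x)))
          (hF0 (H₀ x + jetHessian (j' x))) ha hb hab
        exact (Real.rpow_le_rpow (hF0 _) h1 hp0).trans h2
    _ = ENNReal.ofReal a *
            (∫⁻ x in unitBall d, ENNReal.ofReal (F (H₀ x + jetHessian (j x)) ^ p)) +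
          ENNReal.ofReal b *
            ∫⁻ x in unitBall d, ENNReal.ofReal (F (H₀ x + jetHessian (j' x)) ^ p) := by
        rw [lintegral_add_left' (hm.const_mul _), lintegral_const_mul' _ _ (by simp),
          lintegral_const_mul' _ _ (by simp)]
    _ ≤ ENNReal.ofReal a * M + ENNReal.ofReal b * M :=
        add_le_add (mul_le_mul_right hj _) (mul_le_mul_right hj' _)
    _ = M := by
        rw [← add_mul, ← ENNReal.ofReal_add ha hb, hab, ENNReal.ofReal_one, one_mul]

theorem isClosed_energySublevel {d : ℕ} {F : SymMat d → ℝ} (hFc : Continuous F) {p : ℝ}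
    (hp : 0 ≤ p) {H₀ : EuclideanSpace ℝ (Fin d) → SymMat d}
    (hH₀ : AEStronglyMeasurable H₀ (ballMeasure d)) (P M : ℝ≥0∞) [hP : Fact (1 ≤ P)] :
    IsClosed (energySublevel F p H₀ P M) := by
  refine isClosed_of_closure_subset fun j hj => ?_
  obtain ⟨f, hfS, hfj⟩ := mem_closure_iff_seq_limit.1 hj
  obtain ⟨ns, -, hns⟩ := (tendstoInMeasure_of_tendsto_Lp hfj).exists_seq_tendsto_ae
  have h2 : Continuous fun M : SymMat d => ENNReal.ofReal (F M ^ p) :=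
    ENNReal.continuous_ofReal.comp ((Real.continuous_rpow_const hp).comp hFc)
  calc ∫⁻ x in unitBall d, ENNReal.ofReal (F (H₀ x + jetHessian (j x)) ^ p)
      = ∫⁻ x in unitBall d, liminf (fun n =>
          ENNReal.ofReal (F (H₀ x + jetHessian (f (ns n) x)) ^ p)) atTop := by
        refine lintegral_congr_ae ?_
        filter_upwards [hns] with x hx
        have h3 : Tendsto (fun n => H₀ x + jetHessian (f (ns n) x)) atTop
            (𝓝 (H₀ x + jetHessian (j x))) :=
          ((continuous_jetHessian.tendsto _).comp hx).const_add _
        exact ((h2.tendsto _).comp h3).liminf_eq.symm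
    _ ≤ liminf (fun n => ∫⁻ x in unitBall d,
          ENNReal.ofReal (F (H₀ x + jetHessian (f (ns n) x)) ^ p)) atTop :=
        lintegral_liminf_le' fun n => aemeasurable_energy hFc hp hH₀ (f (ns n))
    _ ≤ M := liminf_le_of_frequently_le' (Frequently.of_forall fun n => hfS (ns n))

/-- The jets whose value component is at `L¹`-distance at most `δ` from `w`. -/
def valueBall {d : ℕ} (P : ℝ≥0∞) (w : EuclideanSpace ℝ (Fin d) → ℝ) (δ : ℝ≥0∞) :
    Set (Lp (Jet d) P (ballMeasure d)) :=
  {j | eLpNorm (fun x => jetValue (j x) - w x) 1 (ballMeasure d) ≤ δ}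

theorem convex_valueBall {d : ℕ} (P : ℝ≥0∞) {w : EuclideanSpace ℝ (Fin d) → ℝ}
    (hw : AEStronglyMeasurable w (ballMeasure d)) (δ : ℝ≥0∞) : Convex ℝ (valueBall P w δ) := by
  intro j hj j' hj' a b ha hb hab
  have hm := (Lp.memLp_jetValue j).1.sub hw
  have hm' := (Lp.memLp_jetValue j').1.sub hw
  calc eLpNorm (fun x => jetValue ((a • j + b • j' : Lp (Jet d) P _) x) - w x) 1 (ballMeasure d)
      = eLpNorm ((a • fun x => jetValue (j x) - w x) + b • fun x => jetValue (j' x) - w x) 1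
          (ballMeasure d) := by
        refine eLpNorm_congr_ae ?_
        filter_upwards [Lp.coeFn_lincomb a b j j'] with x hx
        rw [hx, jetValue_lincomb]
        simp only [Pi.add_apply, Pi.smul_apply, smul_eq_mul]
        linear_combination (w x) * hab
    _ ≤ eLpNorm (a • fun x => jetValue (j x) - w x) 1 (ballMeasure d) +
          eLpNorm (b • fun x => jetValue (j' x) - w x) 1 (ballMeasure d) :=
        eLpNorm_add_le (hm.const_smul a) (hm'.const_smul b) le_rfl
    _ ≤ ENNReal.ofReal a * δ + ENNReal.ofReal b * δ := by
        rw [eLpNorm_const_smul, eLpNorm_const_smul, ← ofReal_norm, ← ofReal_norm,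
          Real.norm_of_nonneg ha, Real.norm_of_nonneg hb]
        exact add_le_add (mul_le_mul_right hj _) (mul_le_mul_right hj' _)
    _ = δ := by rw [← add_mul, ← ENNReal.ofReal_add ha hb, hab, ENNReal.ofReal_one, one_mul]

theorem isClosed_valueBall {d : ℕ} (P : ℝ≥0∞) [hP : Fact (1 ≤ P)]
    {w : EuclideanSpace ℝ (Fin d) → ℝ} (hw : AEStronglyMeasurable w (ballMeasure d))
    (δ : ℝ≥0∞) : IsClosed (valueBall P w δ) := by
  refine isClosed_of_closure_subset fun j hj => ?_
  rw [Metric.mem_closure_iff] at hj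
  obtain ⟨C, hC, hCle⟩ := exists_eLpNorm_one_le (μ := ballMeasure d) hP.out
  change eLpNorm (fun x => jetValue (j x) - w x) 1 (ballMeasure d) ≤ δ
  refine le_of_forall_pos_le_add fun ε hε => ?_
  obtain ⟨η, hη, hηε⟩ := ENNReal.exists_pos_mul_ofReal_lt hC hε.ne'
  obtain ⟨j', hj', hd⟩ := hj η hη
  have hm := (Lp.memLp_jetValue j).1
  have hm' := (Lp.memLp_jetValue j').1
  have h1 := eLpNorm_add_le (hm'.sub hw) (hm.sub hm') (le_refl (1 : ℝ≥0∞))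
  have e1 : ((fun x => jetValue (j' x)) - w) +
      ((fun x => jetValue (j x)) - fun x => jetValue (j' x)) =
        fun x => jetValue (j x) - w x := by
    ext x; simp only [Pi.add_apply, Pi.sub_apply]; ring
  rw [e1] at h1
  refine h1.trans (add_le_add hj' ?_)
  refine (hCle _ (hm.sub hm')).trans (le_trans (mul_le_mul_right ?_ _) hηε.le)
  exact (Lp.eLpNorm_jet_sub_apply_le j j' _).trans (ENNReal.ofReal_le_ofReal hd.le)

/-! ### Compactness of sequences with bounded Hessian and zero boundary values -/

theorem norm_le_sum_norm_apply {ι : Type*} [Fintype ι] (x : EuclideanSpace ℝ ι) :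
    ‖x‖ ≤ ∑ i, ‖x i‖ := by
  classical
  calc ‖x‖ = ‖∑ i, EuclideanSpace.single i (x i)‖ := by
        congr 1
        ext k
        simp [Finset.sum_apply, Pi.single_apply]
    _ ≤ ∑ i, ‖(EuclideanSpace.single i (x i) : EuclideanSpace ℝ ι)‖ := norm_sum_le _ _
    _ = ∑ i, ‖x i‖ := by simp

theorem eLpNorm_le_sum_eLpNorm_apply {ι α : Type*} [Fintype ι] [MeasurableSpace α]
    {μ : Measure α} {P : ℝ≥0∞} (hP : 1 ≤ P) {f : α → EuclideanSpace ℝ ι}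
    (hf : ∀ i, AEStronglyMeasurable (fun x => f x i) μ) :
    eLpNorm f P μ ≤ ∑ i, eLpNorm (fun x => f x i) P μ := by
  calc eLpNorm f P μ ≤ eLpNorm (∑ i, fun x => ‖f x i‖) P μ := by
        refine eLpNorm_mono_real fun x => ?_
        rw [Finset.sum_apply]
        exact norm_le_sum_norm_apply _
    _ ≤ ∑ i, eLpNorm (fun x => ‖f x i‖) P μ := eLpNorm_sum_le (fun i _ => (hf i).norm) hP
    _ = _ := by simp only [eLpNorm_norm]

theorem norm_fderiv_le_sum_partialDeriv {d : ℕ} (f : EuclideanSpace ℝ (Fin d) → ℝ)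
    (x : EuclideanSpace ℝ (Fin d)) : ‖fderiv ℝ f x‖ ≤ ∑ i, ‖partialDeriv i f x‖ := by
  refine ContinuousLinearMap.opNorm_le_bound _ (Finset.sum_nonneg fun i _ => norm_nonneg _)
    fun v => ?_
  have hv : v = ∑ i, v i • (EuclideanSpace.single i 1 : EuclideanSpace ℝ (Fin d)) := by
    ext k
    simp [Finset.sum_apply, Pi.single_apply]
  nth_rewrite 1 [hv]
  rw [map_sum, Finset.sum_mul]
  refine (norm_sum_le _ _).trans (Finset.sum_le_sum fun i _ => ?_)
  rw [map_smul, norm_smul, mul_comm]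
  exact mul_le_mul_of_nonneg_left (PiLp.norm_apply_le v i) (norm_nonneg _)

theorem lintegral_enorm_testFunction {d : ℕ} (φ : 𝓓(unitBall d, ℝ)) :
    ∫⁻ x, ‖φ x‖ₑ = eLpNorm φ 1 (ballMeasure d) := by
  rw [eLpNorm_one_eq_lintegral_enorm, ← lintegral_indicator (unitBall d).isOpen.measurableSet]
  refine lintegral_congr fun x => ?_
  by_cases hx : x ∈ (unitBall d : Set (EuclideanSpace ℝ (Fin d)))
  · rw [Set.indicator_of_mem hx]
  · rw [Set.indicator_of_notMem hx,
      image_eq_zero_of_notMem_tsupport fun h => hx (φ.tsupport_subset h), enorm_zero]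

/-- Rellich's theorem for limits of test functions. -/
theorem exists_subseq_tendsto_of_isTestLimit {d : ℕ} {P : ℝ≥0∞} (hP : 1 ≤ P)
    {w : ℕ → EuclideanSpace ℝ (Fin d) → ℝ}
    {G : ℕ → EuclideanSpace ℝ (Fin d) → EuclideanSpace ℝ (Fin d)}
    (h : ∀ n, IsTestLimit P (w n) (G n)) (hw : ∀ n, AEStronglyMeasurable (w n) (ballMeasure d))
    (hG : ∀ n i, AEStronglyMeasurable (fun x => G n x i) (ballMeasure d))
    {C : ℝ≥0∞} (hC : C ≠ ⊤) (hwC : ∀ n, eLpNorm (w n) P (ballMeasure d) ≤ C)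
    (hGC : ∀ n i, eLpNorm (fun x => G n x i) P (ballMeasure d) ≤ C) :
    ∃ σ : ℕ → ℕ, StrictMono σ ∧ ∃ v : EuclideanSpace ℝ (Fin d) → ℝ,
      AEStronglyMeasurable v (ballMeasure d) ∧
      Tendsto (fun n => eLpNorm (fun x => w (σ n) x - v x) 1 (ballMeasure d)) atTop (𝓝 0) := by
  obtain ⟨K, hK, hKle⟩ := exists_eLpNorm_one_le (μ := ballMeasure d) hP
  choose φ hφ hφ' using fun n : ℕ => h n (1 / ((n : ℝ) + 1)) (by positivity)
  have hone : ∀ n : ℕ, ENNReal.ofReal (1 / ((n : ℝ) + 1)) ≤ 1 := fun n => by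
    rw [ENNReal.ofReal_le_one, div_le_one (by positivity)]
    linarith [Nat.cast_nonneg (α := ℝ) n]
  have hbd : ∀ (f : EuclideanSpace ℝ (Fin d) → ℝ) (χ : 𝓓(unitBall d, ℝ)),
      AEStronglyMeasurable f (ballMeasure d) → eLpNorm f P (ballMeasure d) ≤ C →
      eLpNorm (fun x => f x - χ x) P (ballMeasure d) ≤ 1 →
      ∫⁻ x, ‖χ x‖ₑ ≤ K * (C + 1) := by
    intro f χ hf hfC hfχ
    have hχ := aestronglyMeasurable_testFunction χ (ballMeasure d)
    rw [lintegral_enorm_testFunction]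
    refine (hKle _ hχ).trans (mul_le_mul_right ?_ _)
    have h1 := eLpNorm_sub_le hf (hf.sub hχ) hP
    rw [sub_sub_cancel] at h1
    exact h1.trans (add_le_add hfC hfχ)
  have hb0 : ∀ n, ∫⁻ x, ‖φ n x‖ₑ ≤ (d + 1) * (K * (C + 1)) := fun n => by
    refine (hbd _ (φ n) (hw n) (hwC n) ((hφ n).le.trans (hone n))).trans ?_
    exact le_mul_of_one_le_left' (by simp)
  have hb1 : ∀ n, ∫⁻ x, ‖fderiv ℝ (φ n) x‖ₑ ≤ (d + 1) * (K * (C + 1)) := fun n => by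
    calc ∫⁻ x, ‖fderiv ℝ (φ n) x‖ₑ ≤ ∫⁻ x, ∑ i, ‖partialDerivTest i (φ n) x‖ₑ := by
          refine lintegral_mono fun x => ?_
          simp only [← ofReal_norm]
          rw [← ENNReal.ofReal_sum_of_nonneg fun i _ => norm_nonneg _]
          exact ENNReal.ofReal_le_ofReal (norm_fderiv_le_sum_partialDeriv _ _)
      _ = ∑ i, ∫⁻ x, ‖partialDerivTest i (φ n) x‖ₑ :=
          lintegral_finsetSum _ fun i _ => (partialDerivTest i (φ n)).continuous.measurable.enorm
      _ ≤ ∑ _i : Fin d, K * (C + 1) := Finset.sum_le_sum fun i _ =>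
          hbd _ (partialDerivTest i (φ n)) (hG n i) (hGC n i) ((hφ' n i).le.trans (hone n))
      _ = d * (K * (C + 1)) := by simp
      _ ≤ _ := mul_le_mul_left le_self_add _
  obtain ⟨σ, hσ, v, hv, hlim⟩ := exists_subseq_tendsto_eLpNorm_one (μ := volume) (R := 1)
    (φ := fun n => φ n) (fun n => (φ n).contDiff.of_le (by exact_mod_cast le_top))
    (fun n => (φ n).tsupport_subset.trans Metric.ball_subset_closedBall)
    (ENNReal.mul_ne_top (by simp) (ENNReal.mul_ne_top hK (by simp [hC]))) hb0 hb1
  have hvm : AEStronglyMeasurable v (ballMeasure d) := hv.1.restrict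
  refine ⟨σ, hσ, v, hvm, ?_⟩
  have ht1 : Tendsto (fun n => K * ENNReal.ofReal (1 / ((σ n : ℝ) + 1))) atTop (𝓝 0) := by
    have h1 := ENNReal.tendsto_ofReal (tendsto_one_div_add_atTop_nhds_zero_nat (𝕜 := ℝ))
    have h2 := ENNReal.Tendsto.const_mul (a := K) (h1.comp hσ.tendsto_atTop) (Or.inr hK)
    simpa using h2
  have ht2 := ht1.add hlim
  rw [add_zero] at ht2
  refine tendsto_of_tendsto_of_tendsto_of_le_of_le tendsto_const_nhds ht2 (fun n => zero_le)
    fun n => ?_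
  have hφm := aestronglyMeasurable_testFunction (φ (σ n)) (ballMeasure d)
  have h1 := eLpNorm_add_le ((hw (σ n)).sub hφm) (hφm.sub hvm) (le_refl (1 : ℝ≥0∞))
  rw [sub_add_sub_cancel] at h1
  refine h1.trans (add_le_add ?_ ?_)
  · exact (hKle _ ((hw _).sub hφm)).trans (mul_le_mul_right (hφ (σ n)).le _)
  · exact eLpNorm_mono_measure _ Measure.restrict_le_self

theorem memLp_mkJet {d : ℕ} {P : ℝ≥0∞} {w : EuclideanSpace ℝ (Fin d) → ℝ}
    {G : EuclideanSpace ℝ (Fin d) → EuclideanSpace ℝ (Fin d)}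
    {H : EuclideanSpace ℝ (Fin d) → SymMat d} (hw : MemLp w P (ballMeasure d))
    (hG : ∀ i, MemLp (fun x => G x i) P (ballMeasure d))
    (hH : ∀ i k, MemLp (fun x => (H x).1 i k) P (ballMeasure d)) :
    MemLp (fun x => mkJet (w x) (G x) (H x)) P (ballMeasure d) := by
  refine MemLp.of_eval_piLp ?_
  rintro ((_ | i) | ⟨i, k⟩)
  · exact hw
  · exact hG i
  · exact hH i k

theorem aestronglyMeasurable_symMat {d : ℕ} {P : ℝ≥0∞}
    {H : EuclideanSpace ℝ (Fin d) → SymMat d}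
    (hH : ∀ i k, MemLp (fun x => (H x).1 i k) P (ballMeasure d)) :
    AEStronglyMeasurable H (ballMeasure d) := by
  have h := (memLp_mkJet (w := fun _ => 0) (G := fun _ => 0) MemLp.zero' (fun i => MemLp.zero')
    hH).1
  have h2 := (continuous_jetHessian (d := d)).comp_aestronglyMeasurable h
  simpa only [jetHessian_mkJet] using h2

/-- Compactness and lower semicontinuity: a sequence with zero boundary values and Hessians bounded
in `L^p` has a subsequence converging in `L¹` to the value component of a jet with zero boundary
values, and no energy of the limit exceeds an eventual bound of the energies of the subsequence. -/
theorem exists_subseq_tendsto_zeroBoundaryJet {d : ℕ} (hd : 1 ≤ d) {p : ℝ} (hp : 1 < p)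
    {F : SymMat d → ℝ} (hF : ConvexOn ℝ Set.univ F) (hFc : Continuous F) (hF0 : ∀ M, 0 ≤ F M)
    {H₀ : EuclideanSpace ℝ (Fin d) → SymMat d} (hH₀ : AEStronglyMeasurable H₀ (ballMeasure d))
    {w : ℕ → EuclideanSpace ℝ (Fin d) → ℝ}
    {G : ℕ → EuclideanSpace ℝ (Fin d) → EuclideanSpace ℝ (Fin d)}
    {H : ℕ → EuclideanSpace ℝ (Fin d) → SymMat d}
    (hl : ∀ n, IsTestLimit (ENNReal.ofReal p) (w n) (G n))
    (hw : ∀ n, MemLp (w n) (ENNReal.ofReal p) (ballMeasure d))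
    (hG : ∀ n i, MemLp (fun x => G n x i) (ENNReal.ofReal p) (ballMeasure d))
    (hH : ∀ n, HasWeakHessian (unitBall d) (w n) (H n))
    (hHp : ∀ n i k, MemLp (fun x => (H n x).1 i k) (ENNReal.ofReal p) (ballMeasure d))
    {C : ℝ≥0∞} (hC : C ≠ ⊤)
    (hHC : ∀ n i k, eLpNorm (fun x => (H n x).1 i k) (ENNReal.ofReal p) (ballMeasure d) ≤ C) :
    ∃ σ : ℕ → ℕ, StrictMono σ ∧ ∃ j ∈ zeroBoundaryJets d (ENNReal.ofReal p),
      Tendsto (fun n => eLpNorm (fun x => w (σ n) x - jetValue (j x)) 1 (ballMeasure d))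
        atTop (𝓝 0) ∧
      ∀ M : ℝ≥0∞, (∀ᶠ n in atTop,
        ∫⁻ x in unitBall d, ENNReal.ofReal (F (H₀ x + H (σ n) x) ^ p) ≤ M) →
        ∫⁻ x in unitBall d, ENNReal.ofReal (F (H₀ x + jetHessian (j x)) ^ p) ≤ M := by
  have hP : 1 ≤ ENNReal.ofReal p := by simpa using ENNReal.ofReal_le_ofReal hp.le
  have : Fact (1 ≤ ENNReal.ofReal p) := ⟨hP⟩
  have hG4 : ∀ n i, eLpNorm (fun x => G n x i) (ENNReal.ofReal p) (ballMeasure d) ≤ 4 * C :=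
    fun n i => ((hl n).eLpNorm_gradient_le hp.le (hw n) (hG n) (hH n) i (hHp n i i)).trans
      (mul_le_mul_right (hHC n i i) _)
  have hw16 : ∀ n, eLpNorm (w n) (ENNReal.ofReal p) (ballMeasure d) ≤ 4 * (4 * C) := fun n =>
    ((hl n).eLpNorm_le hp.le (hw n).1 (fun i => (hG n i).1) ⟨0, hd⟩).trans
      (mul_le_mul_right (hG4 n _) _)
  have h4 : ∀ c : ℝ≥0∞, c ≤ 4 * c := fun c => le_mul_of_one_le_left' (by norm_num)
  have hCtop : 4 * (4 * C) ≠ ⊤ := ENNReal.mul_ne_top (by simp) (ENNReal.mul_ne_top (by simp) hC)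
  obtain ⟨σ, hσ, v, hvm, hv⟩ := exists_subseq_tendsto_of_isTestLimit hP hl (fun n => (hw n).1)
    (fun n i => (hG n i).1) hCtop hw16 fun n i => (hG4 n i).trans (h4 _)
  have hmem : ∀ n, MemLp (fun x => mkJet (w n x) (G n x) (H n x)) (ENNReal.ofReal p)
      (ballMeasure d) := fun n => memLp_mkJet (hw n) (hG n) (hHp n)
  let f : ℕ → Lp (Jet d) (ENNReal.ofReal p) (ballMeasure d) := fun n => (hmem (σ n)).toLp _
  have hf : ∀ n, f n =ᵐ[ballMeasure d] fun x => mkJet (w (σ n) x) (G (σ n) x) (H (σ n) x) :=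
    fun n => (hmem (σ n)).coeFn_toLp
  have hfB : ∃ D : ℝ, ∀ n, ‖f n‖ ≤ D := by
    have htop : (∑ _k : Option (Fin d) ⊕ Fin d × Fin d, 4 * (4 * C)) ≠ ⊤ :=
      ENNReal.sum_ne_top.2 fun _ _ => hCtop
    refine ⟨(∑ _k : Option (Fin d) ⊕ Fin d × Fin d, 4 * (4 * C)).toReal, fun n => ?_⟩
    rw [Lp.norm_toLp]
    refine ENNReal.toReal_mono htop ((eLpNorm_le_sum_eLpNorm_apply hP
      fun k => ((hmem (σ n)).eval_piLp k).1).trans (Finset.sum_le_sum fun k _ => ?_))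
    rcases k with (_ | i) | ⟨i, k⟩
    · exact hw16 _
    · exact (hG4 _ i).trans (h4 _)
    · exact (hHC _ i k).trans ((h4 _).trans (h4 _))
  obtain ⟨D, hD⟩ := hfB
  obtain ⟨j, hj⟩ := exists_forall_mem_closure_convexHull_tail (by linarith : 0 < p)
    (fun ε hε => Lp.exists_norm_sub_rpow_le (E := Jet d) hp hε) f hD
  -- a closed convex set containing a tail of the sequence contains `j`
  have htail : ∀ S : Set (Lp (Jet d) (ENNReal.ofReal p) (ballMeasure d)), Convex ℝ S →
      IsClosed S → (∀ᶠ n in atTop, f n ∈ S) → j ∈ S := by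
    intro S hSc hScl hS
    obtain ⟨N, hN⟩ := eventually_atTop.1 hS
    refine closure_minimal (convexHull_min ?_ hSc) hScl (hj N)
    rintro _ ⟨n, hn, rfl⟩
    exact hN n hn
  have hjv : (fun x => jetValue (j x)) =ᵐ[ballMeasure d] v := by
    have h0 : eLpNorm (fun x => jetValue (j x) - v x) 1 (ballMeasure d) = 0 := by
      refine nonpos_iff_eq_zero.1 (le_of_forall_pos_le_add fun ε hε => ?_)
      rw [zero_add]
      refine htail (valueBall (ENNReal.ofReal p) v ε) (convex_valueBall _ hvm ε)
        (isClosed_valueBall _ hvm ε) ?_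
      filter_upwards [hv.eventually (gt_mem_nhds hε)] with n hn
      refine le_of_eq_of_le (eLpNorm_congr_ae ?_) hn.le
      filter_upwards [hf n] with x hx
      rw [hx]; rfl
    filter_upwards [(eLpNorm_eq_zero_iff ((Lp.memLp_jetValue j).1.sub hvm) one_ne_zero).1 h0]
      with x hx using sub_eq_zero.1 hx
  refine ⟨σ, hσ, j, ?_, ?_, fun M hM => ?_⟩
  · refine htail _ (convex_zeroBoundaryJets hP) isClosed_zeroBoundaryJets
      (Eventually.of_forall fun n => ⟨?_, fun φ i k => ?_⟩)
    · refine (hl (σ n)).congr_ae ?_ ?_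
      · filter_upwards [hf n] with x hx
        rw [hx]; rfl
      · filter_upwards [hf n] with x hx
        rw [hx]; rfl
    · have h1 := (hH (σ n)).2.2 φ i k
      calc _ = _ := by
            refine integral_congr_ae ?_
            filter_upwards [hf n] with x hx
            rw [hx]; rfl
        _ = _ := h1
        _ = _ := by
            refine integral_congr_ae ?_
            filter_upwards [hf n] with x hx
            rw [hx, jetHessian_mkJet]
  · refine hv.congr fun n => eLpNorm_congr_ae ?_
    filter_upwards [hjv] with x hx
    rw [hx]
  · refine htail (energySublevel F p H₀ _ M) (convex_energySublevel hF hFc hF0 hp.le hH₀ _ M)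
      (isClosed_energySublevel hFc (by linarith) hH₀ _ M) ?_
    filter_upwards [hM] with n hn
    refine le_of_eq_of_le (lintegral_congr_ae ?_) hn
    filter_upwards [hf n] with x hx
    rw [hx, jetHessian_mkJet]

/-! ### Admissible functions and the direct method -/

theorem SymMat.norm_apply_le {d : ℕ} (M : SymMat d) (i k : Fin d) : ‖M.1 i k‖ ≤ ‖M‖ := by
  change ‖M.1 i k‖ ≤ ‖M.1‖
  rw [Matrix.frobenius_norm_def, ← Real.sqrt_eq_rpow]
  refine Real.le_sqrt_of_sq_le ?_
  rw [← Real.rpow_two]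
  calc ‖M.1 i k‖ ^ (2 : ℝ) ≤ ∑ k', ‖M.1 i k'‖ ^ (2 : ℝ) :=
        Finset.single_le_sum (f := fun k' => ‖M.1 i k'‖ ^ (2 : ℝ))
          (fun k' _ => Real.rpow_nonneg (norm_nonneg _) _) (Finset.mem_univ k)
    _ ≤ _ := Finset.single_le_sum (f := fun i' => ∑ k', ‖M.1 i' k'‖ ^ (2 : ℝ))
          (fun i' _ => Finset.sum_nonneg fun k' _ => Real.rpow_nonneg (norm_nonneg _) _)
          (Finset.mem_univ i)

theorem GrowthCondition.nonneg {d : ℕ} {F : SymMat d → ℝ} {lam : ℝ} (h : GrowthCondition F lam)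
    (M : SymMat d) : 0 ≤ F M :=
  (mul_nonneg (by have := h.1; positivity) (norm_nonneg M)).trans (h.2.1 M).1

theorem GrowthCondition.norm_apply_le {d : ℕ} {F : SymMat d → ℝ} {lam : ℝ}
    (h : GrowthCondition F lam) (M : SymMat d) (i k : Fin d) : ‖M.1 i k‖ ≤ lam * F M := by
  have hlam : 0 < lam := by linarith [h.1]
  refine (SymMat.norm_apply_le M i k).trans ?_
  have := mul_le_mul_of_nonneg_left (h.2.1 M).1 hlam.le
  rwa [← mul_assoc, mul_one_div_cancel hlam.ne', one_mul] at this

theorem GrowthCondition.eLpNorm_apply_le {d : ℕ} {F : SymMat d → ℝ} {lam : ℝ}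
    (h : GrowthCondition F lam) {p : ℝ} (hp : 0 < p) (H : EuclideanSpace ℝ (Fin d) → SymMat d)
    {A : ℝ≥0∞} (hA : ∫⁻ x in unitBall d, ENNReal.ofReal (F (H x) ^ p) ≤ A) (i k : Fin d) :
    eLpNorm (fun x => (H x).1 i k) (ENNReal.ofReal p) (ballMeasure d) ≤
      (ENNReal.ofReal (lam ^ p) * A) ^ (1 / p) := by
  have hlam : 0 < lam := by linarith [h.1]
  rw [eLpNorm_eq_lintegral_rpow_enorm_toReal (by simpa using hp) (by simp),
    ENNReal.toReal_ofReal hp.le]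
  refine ENNReal.rpow_le_rpow ?_ (by positivity)
  calc ∫⁻ x, ‖(H x).1 i k‖ₑ ^ p ∂ballMeasure d
      ≤ ∫⁻ x in unitBall d, ENNReal.ofReal (lam ^ p) * ENNReal.ofReal (F (H x) ^ p) := by
        refine lintegral_mono fun x => ?_
        rw [← ofReal_norm, ENNReal.ofReal_rpow_of_nonneg (norm_nonneg _) hp.le,
          ← ENNReal.ofReal_mul (by positivity), ← Real.mul_rpow hlam.le (h.nonneg _)]
        exact ENNReal.ofReal_le_ofReal
          (Real.rpow_le_rpow (norm_nonneg _) (h.norm_apply_le _ i k) hp.le)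
    _ = ENNReal.ofReal (lam ^ p) * ∫⁻ x in unitBall d, ENNReal.ofReal (F (H x) ^ p) :=
        lintegral_const_mul' _ _ (by simp)
    _ ≤ _ := mul_le_mul_right hA _

theorem memAffineSobolev_self {d : ℕ} {P : ℝ≥0∞} (hP : 1 ≤ P)
    {g : EuclideanSpace ℝ (Fin d) → ℝ} (hg : MemW2pLoc (unitBall d) P g) :
    MemAffineSobolev (unitBall d) P g g := by
  refine ⟨hg, ?_⟩
  have h0 : IsTestLimit (d := d) P (fun x => g x - g x) 0 := by
    intro ε hε
    have hz : ∀ i, partialDeriv i (⇑(0 : 𝓓(unitBall d, ℝ))) = 0 := by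
      intro i
      ext x
      have : (⇑(0 : 𝓓(unitBall d, ℝ))) = fun _ => (0 : ℝ) := rfl
      simp [partialDeriv, this]
    refine ⟨0, ?_, fun i => ?_⟩
    · have e : (fun x => g x - g x - (0 : 𝓓(unitBall d, ℝ)) x) = fun _ => (0 : ℝ) := by
        ext x
        change g x - g x - 0 = 0
        ring
      rw [e]
      simpa using hε
    · rw [hz]
      simpa using hε
  exact h0.memW1pZero hP (by simp) (fun i => by simp)

theorem MemLpLoc.add {d : ℕ} {Ω : TopologicalSpace.Opens (EuclideanSpace ℝ (Fin d))} {P : ℝ≥0∞}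
    {f g : EuclideanSpace ℝ (Fin d) → ℝ} (hf : MemLpLoc Ω P f) (hg : MemLpLoc Ω P g) :
    MemLpLoc Ω P (fun x => f x + g x) := fun K hK hKΩ => (hf K hK hKΩ).add (hg K hK hKΩ)

theorem MemAffineSobolev.add_zeroBoundaryJet {d : ℕ} {P : ℝ≥0∞} (hP : 1 ≤ P)
    {g u : EuclideanSpace ℝ (Fin d) → ℝ} (hu : MemAffineSobolev (unitBall d) P g u)
    {j : Lp (Jet d) P (ballMeasure d)} (hj : j ∈ zeroBoundaryJets d P) :
    MemAffineSobolev (unitBall d) P g (fun x => u x + jetValue (j x)) := by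
  have hwk := hj.1.hasWeakGradient hP (Lp.memLp_jetValue j) (Lp.memLp_jetGradient j)
  have hwH := hasWeakHessian_of_mem_zeroBoundaryJets hP hj
  obtain ⟨⟨hu0, ⟨G, hG, hGp⟩, H, hH, hHp⟩, huz, K, hK, hKp, hKl⟩ := hu
  refine ⟨⟨hu0.add (Lp.memLp_jetValue j).memLpLoc_unitBall,
    ⟨fun x => G x + jetGradient (j x), ?_,
      fun i => (hGp i).add (Lp.memLp_jetGradient j i).memLpLoc_unitBall⟩,
    fun x => H x + jetHessian (j x), ?_,
      fun i k => (hHp i k).add (Lp.memLp_jetHessian j i k).memLpLoc_unitBall⟩, ?_⟩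
  · simpa only [one_mul, one_smul] using hG.lincomb hwk 1 1
  · simpa only [one_mul, one_smul] using hH.lincomb hwH 1 1
  · have hKl' : IsTestLimit P (fun x => u x - g x) K := hKl
    have h := hKl'.lincomb hP hj.1 huz.1 (Lp.memLp_jetValue j).1 (fun i => (hKp i).1)
      (fun i => (Lp.memLp_jetGradient j i).1) (a := 1) (b := 1) (by simp) (by simp)
    simp only [one_mul, one_smul] at h
    have h2 := h.memW1pZero hP (huz.add (Lp.memLp_jetValue j))
      (fun i => (hKp i).add (Lp.memLp_jetGradient j i))
    have e : (fun x => u x + jetValue (j x) - g x) = fun x => u x - g x + jetValue (j x) := by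
      ext x; ring
    rw [e]
    exact h2

theorem exists_minimizing_seq {d : ℕ} (F : SymMat d → ℝ) (Λ p : ℝ)
    {P : ℝ≥0∞} {g u₀ : EuclideanSpace ℝ (Fin d) → ℝ} (hu₀ : MemAffineSobolev (unitBall d) P g u₀) :
    ∃ (u : ℕ → EuclideanSpace ℝ (Fin d) → ℝ) (m : ℝ≥0∞),
      (∀ n, MemAffineSobolev (unitBall d) P g (u n) ∧
        hessianFunctional F Λ p (u n) ≤ hessianFunctional F Λ p u₀) ∧
      Tendsto (fun n => hessianFunctional F Λ p (u n)) atTop (𝓝 m) ∧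
      ∀ v, MemAffineSobolev (unitBall d) P g v → m ≤ hessianFunctional F Λ p v := by
  let S : Set ℝ≥0∞ := {c | ∃ v, MemAffineSobolev (unitBall d) P g v ∧
    hessianFunctional F Λ p v ≤ hessianFunctional F Λ p u₀ ∧ hessianFunctional F Λ p v = c}
  have hS : S.Nonempty := ⟨_, u₀, hu₀, le_rfl, rfl⟩
  obtain ⟨c, -, hc, hcS⟩ := exists_seq_tendsto_sInf hS (OrderBot.bddBelow S)
  choose u hu hu' huc using hcS
  refine ⟨u, sInf S, fun n => ⟨hu n, hu' n⟩, by simpa only [huc] using hc, fun v hv => ?_⟩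
  rcases le_total (hessianFunctional F Λ p v) (hessianFunctional F Λ p u₀) with h | h
  · exact sInf_le ⟨v, hv, h, rfl⟩
  · have h₀ : sInf S ≤ hessianFunctional F Λ p u₀ := sInf_le ⟨u₀, hu₀, le_rfl, rfl⟩
    exact h₀.trans h

/-- Lower semicontinuity of the measure of the positivity set under almost everywhere
convergence. -/
theorem measure_pos_le_liminf {α : Type*} [MeasurableSpace α] {μ : Measure α} {u : ℕ → α → ℝ}
    {v : α → ℝ} (hu : ∀ n, AEStronglyMeasurable (u n) μ) (hv : AEStronglyMeasurable v μ)
    (h : ∀ᵐ x ∂μ, Tendsto (fun n => u n x) atTop (𝓝 (v x))) :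
    μ {x | 0 < v x} ≤ liminf (fun n => μ {x | 0 < u n x}) atTop := by
  have hm : ∀ f : α → ℝ, AEStronglyMeasurable f μ → NullMeasurableSet {x | 0 < f x} μ :=
    fun f hf => nullMeasurableSet_lt aemeasurable_const hf.aemeasurable
  calc μ {x | 0 < v x} = ∫⁻ x, {x | 0 < v x}.indicator 1 x ∂μ :=
        (lintegral_indicator_one₀ (hm v hv)).symm
    _ ≤ ∫⁻ x, liminf (fun n => {x | 0 < u n x}.indicator 1 x) atTop ∂μ := by
        refine lintegral_mono_ae ?_
        filter_upwards [h] with x hx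
        by_cases hvx : 0 < v x
        · rw [Set.indicator_of_mem (show x ∈ {x | 0 < v x} from hvx)]
          refine le_liminf_of_le (by isBoundedDefault) ?_
          filter_upwards [hx.eventually (lt_mem_nhds hvx)] with n hn
          rw [Set.indicator_of_mem (show x ∈ {x | 0 < u n x} from hn)]
        · rw [Set.indicator_of_notMem (show x ∉ {x | 0 < v x} from hvx)]
          exact zero_le
    _ ≤ liminf (fun n => ∫⁻ x, {x | 0 < u n x}.indicator 1 x ∂μ) atTop :=
        lintegral_liminf_le' fun n => aemeasurable_const.indicator₀ (hm _ (hu n))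
    _ = _ := by simp only [lintegral_indicator_one₀ (hm _ (hu _))]

theorem mainTheorem4 (d : ℕ) (hd : 1 ≤ d) (p : ℝ) (hp1 : 1 < p) (hp : (d : ℝ) / 2 < p)
    (Λ : ℝ) (hΛ : 0 < Λ)
    (F : SymMat d → ℝ) (hconv : ConvexOn ℝ Set.univ F)
    (lam : ℝ) (hgrowth : GrowthCondition F lam)
    (g : EuclideanSpace ℝ (Fin d) → ℝ)
    (hg : MemW2pLoc (unitBall d) (ENNReal.ofReal p) g)
    (hg_nonneg : ∀ᵐ x ∂(volume.restrict (unitBall d : Set (EuclideanSpace ℝ (Fin d)))), 0 ≤ g x)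
    (hg_nontrivial :
      ¬ ∀ᵐ x ∂(volume.restrict (unitBall d : Set (EuclideanSpace ℝ (Fin d)))), g x = 0) :
    ∃ u : EuclideanSpace ℝ (Fin d) → ℝ,
      MemAffineSobolev (unitBall d) (ENNReal.ofReal p) g u ∧
      ∀ v : EuclideanSpace ℝ (Fin d) → ℝ,
        MemAffineSobolev (unitBall d) (ENNReal.ofReal p) g v →
          hessianFunctional F Λ p u ≤ hessianFunctional F Λ p v := by
  have hp0 : 0 < p := by linarith
  have hP : 1 ≤ ENNReal.ofReal p := by simpa using ENNReal.ofReal_le_ofReal hp1.le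
  have hFc : Continuous F := by
    rw [← continuousOn_univ]
    exact hconv.continuousOn isOpen_univ
  have hF0 : ∀ M, 0 ≤ F M := hgrowth.nonneg
  by_cases htop : ∃ u₀, MemAffineSobolev (unitBall d) (ENNReal.ofReal p) g u₀ ∧
      hessianFunctional F Λ p u₀ ≠ ⊤
  swap
  · -- without a competitor of finite energy, every admissible function is a minimizer
    refine ⟨g, memAffineSobolev_self hP hg, fun v hv => ?_⟩
    have : hessianFunctional F Λ p v = ⊤ := by
      by_contra h
      exact htop ⟨v, hv, h⟩
    rw [this]
    exact le_top
  obtain ⟨u₀, hu₀, hfin⟩ := htop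
  obtain ⟨u, m, hu, hum, hmin⟩ := exists_minimizing_seq F Λ p hu₀
  -- energies converge along a subsequence
  obtain ⟨a, τ, hτ, ha⟩ := CompactSpace.tendsto_subseq fun n =>
    ∫⁻ x in unitBall d, ENNReal.ofReal (F (weakHessian (unitBall d) (u n) x) ^ p)
  let A := hessianFunctional F Λ p u₀
  have hH : ∀ v, MemAffineSobolev (unitBall d) (ENNReal.ofReal p) g v →
      HasWeakHessian (unitBall d) v (weakHessian (unitBall d) v) := fun v hv =>
    hasWeakHessian_weakHessian ⟨_, hv.1.2.2.choose_spec.1⟩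
  let H₀ := weakHessian (unitBall d) u₀
  have hHmem : ∀ v, MemAffineSobolev (unitBall d) (ENNReal.ofReal p) g v →
      hessianFunctional F Λ p v ≤ A → ∀ i k,
      eLpNorm (fun x => (weakHessian (unitBall d) v x).1 i k) (ENNReal.ofReal p)
        (ballMeasure d) ≤ (ENNReal.ofReal (lam ^ p) * A) ^ (1 / p) := fun v hv hvA i k =>
    hgrowth.eLpNorm_apply_le hp0 _ (le_self_add.trans hvA) i k
  have hCtop : (ENNReal.ofReal (lam ^ p) * A) ^ (1 / p) ≠ ⊤ :=
    ENNReal.rpow_ne_top_of_nonneg (by positivity) (ENNReal.mul_ne_top (by simp) hfin)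
  have hHLp : ∀ v, MemAffineSobolev (unitBall d) (ENNReal.ofReal p) g v →
      hessianFunctional F Λ p v ≤ A → ∀ i k,
      MemLp (fun x => (weakHessian (unitBall d) v x).1 i k) (ENNReal.ofReal p)
        (ballMeasure d) := fun v hv hvA i k =>
    ⟨((hH v hv).2.1 i k).aestronglyMeasurable, (hHmem v hv hvA i k).trans_lt hCtop.lt_top⟩
  have hH₀m : AEStronglyMeasurable H₀ (ballMeasure d) :=
    aestronglyMeasurable_symMat (hHLp u₀ hu₀ le_rfl)
  -- the differences `u n - u₀` have zero boundary values
  obtain ⟨hz₀, G₀, -, hG₀, hl₀⟩ := hu₀.2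
  choose G _ hGp hGl using fun n => (hu n).1.2.2
  obtain ⟨σ, hσ, j, hj, hlim, hlsc⟩ := exists_subseq_tendsto_zeroBoundaryJet hd hp1 hconv hFc hF0
    hH₀m (w := fun n x => 1 * (u (τ n) x - g x) + -1 * (u₀ x - g x))
    (G := fun n x => (1 : ℝ) • G (τ n) x + (-1 : ℝ) • G₀ x)
    (H := fun n x => (1 : ℝ) • weakHessian (unitBall d) (u (τ n)) x + (-1 : ℝ) • H₀ x)
    (C := 2 * (ENNReal.ofReal (lam ^ p) * A) ^ (1 / p))
    (fun n => IsTestLimit.lincomb hP (hGl (τ n)) hl₀ (hu (τ n)).1.2.1.1 hz₀.1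
      (fun i => (hGp (τ n) i).1) (fun i => (hG₀ i).1) (by simp) (by simp))
    (fun n => ((hu (τ n)).1.2.1.const_mul 1).add (hz₀.const_mul (-1)))
    (fun n i => ((hGp (τ n) i).const_mul 1).add ((hG₀ i).const_mul (-1)))
    (fun n => by
      have h := (hH _ (hu (τ n)).1).lincomb (hH _ hu₀) 1 (-1)
      have e : (fun x => 1 * (u (τ n) x - g x) + -1 * (u₀ x - g x)) =
          fun x => 1 * u (τ n) x + -1 * u₀ x := by
        ext x; ring
      rw [e]
      exact h)
    (fun n i k => ((hHLp _ (hu (τ n)).1 (hu (τ n)).2 i k).const_mul 1).add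
      ((hHLp _ hu₀ le_rfl i k).const_mul (-1)))
    (ENNReal.mul_ne_top (by simp) hCtop)
    (fun n i k => by
      have h1 := hHmem _ (hu (τ n)).1 (hu (τ n)).2 i k
      have h2 := hHmem _ hu₀ le_rfl i k
      have h3 := eLpNorm_sub_le (hHLp _ (hu (τ n)).1 (hu (τ n)).2 i k).1
        (hHLp _ hu₀ le_rfl i k).1 hP
      rw [two_mul]
      refine le_of_eq_of_le (congrArg (eLpNorm · (ENNReal.ofReal p) (ballMeasure d))
        (funext fun x => ?_)) (h3.trans (add_le_add h1 h2))
      change 1 * (weakHessian (unitBall d) (u (τ n)) x).1 i k + -1 * (H₀ x).1 i k =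
        (weakHessian (unitBall d) (u (τ n)) x).1 i k - (H₀ x).1 i k
      ring)
  let v : EuclideanSpace ℝ (Fin d) → ℝ := fun x => u₀ x + jetValue (j x)
  have hv : MemAffineSobolev (unitBall d) (ENNReal.ofReal p) g v := hu₀.add_zeroBoundaryJet hP hj
  refine ⟨v, hv, fun v' hv' => le_trans ?_ (hmin v' hv')⟩
  -- the energy of the limit
  have hvH : weakHessian (unitBall d) v =ᵐ[ballMeasure d] fun x => H₀ x + jetHessian (j x) := by
    have h := (hH _ hu₀).lincomb (hasWeakHessian_of_mem_zeroBoundaryJets hP hj) 1 1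
    simp only [one_mul, one_smul] at h
    exact (hH v hv).ae_eq h
  have haσ := ha.comp hσ.tendsto_atTop
  have hva : ∫⁻ x in unitBall d, ENNReal.ofReal (F (weakHessian (unitBall d) v x) ^ p) ≤ a := by
    have e : ∫⁻ x in unitBall d, ENNReal.ofReal (F (weakHessian (unitBall d) v x) ^ p) =
        ∫⁻ x in unitBall d, ENNReal.ofReal (F (H₀ x + jetHessian (j x)) ^ p) := by
      refine lintegral_congr_ae ?_
      filter_upwards [hvH] with x hx
      rw [hx]
    rw [e]
    refine le_of_forall_gt_imp_ge_of_dense fun M hM => hlsc M ?_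
    filter_upwards [haσ.eventually (gt_mem_nhds hM)] with n hn
    refine le_of_eq_of_le (lintegral_congr fun x => ?_) hn.le
    have e2 : H₀ x + ((1 : ℝ) • weakHessian (unitBall d) (u (τ (σ n))) x + (-1 : ℝ) • H₀ x) =
        weakHessian (unitBall d) (u (τ (σ n))) x := by module
    rw [e2]
  -- the positivity set of the limit
  have hum' : ∀ n, AEStronglyMeasurable (u n) (ballMeasure d) := fun n =>
    (hH _ (hu n).1).1.aestronglyMeasurable
  have hu₀m : AEStronglyMeasurable u₀ (ballMeasure d) := (hH _ hu₀).1.aestronglyMeasurable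
  have hvm : AEStronglyMeasurable v (ballMeasure d) := (hH _ hv).1.aestronglyMeasurable
  have hlim' : Tendsto (fun n => eLpNorm (u (τ (σ n)) - v) 1 (ballMeasure d)) atTop (𝓝 0) := by
    refine hlim.congr fun n => congrArg (eLpNorm · 1 (ballMeasure d)) (funext fun x => ?_)
    change 1 * (u (τ (σ n)) x - g x) + -1 * (u₀ x - g x) - jetValue (j x) =
      u (τ (σ n)) x - (u₀ x + jetValue (j x))
    ring
  obtain ⟨ρ, hρ, hae⟩ := (tendstoInMeasure_of_tendsto_eLpNorm one_ne_zero
    (fun n => hum' (τ (σ n))) hvm hlim').exists_seq_tendsto_ae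
  have hpos := measure_pos_le_liminf (fun n => hum' (τ (σ (ρ n)))) hvm hae
  have hball : ∀ f : EuclideanSpace ℝ (Fin d) → ℝ, ballMeasure d {x | 0 < f x} =
      volume ({x | 0 < f x} ∩ (unitBall d : Set (EuclideanSpace ℝ (Fin d)))) := fun f =>
    Measure.restrict_apply' (unitBall d).isOpen.measurableSet
  have haρ := haσ.comp hρ.tendsto_atTop
  have hmρ := hum.comp ((hτ.comp (hσ.comp hρ)).tendsto_atTop)
  have haA : a ≤ A := le_of_tendsto' haρ fun n => le_self_add.trans (hu (τ (σ (ρ n)))).2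
  have hatop : a ≠ ⊤ := ne_top_of_le_ne_top hfin haA
  have ham : a ≤ m := le_of_tendsto_of_tendsto' haρ hmρ fun n => le_self_add
  have hdiff : Tendsto (fun n => ENNReal.ofReal Λ *
      ballMeasure d {x | 0 < u (τ (σ (ρ n))) x}) atTop (𝓝 (m - a)) := by
    refine (ENNReal.Tendsto.sub hmρ haρ (Or.inr hatop)).congr fun n => ?_
    simp only [Function.comp_apply, hessianFunctional, hball]
    exact ENNReal.add_sub_cancel_left
      (ne_top_of_le_ne_top hfin (le_self_add.trans (hu (τ (σ (ρ n)))).2))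
  calc hessianFunctional F Λ p v
      ≤ a + ENNReal.ofReal Λ * ballMeasure d {x | 0 < v x} := by
        rw [hessianFunctional, ← hball]
        exact add_le_add_left hva _
    _ ≤ a + (m - a) := by
        refine add_le_add_right ?_ _
        have hΛ0 : ENNReal.ofReal Λ ≠ 0 := by simpa using hΛ
        calc ENNReal.ofReal Λ * ballMeasure d {x | 0 < v x}
            ≤ ENNReal.ofReal Λ *
                liminf (fun n => ballMeasure d {x | 0 < u (τ (σ (ρ n))) x}) atTop :=
              mul_le_mul_right hpos _
          _ = liminf (fun n => ENNReal.ofReal Λ *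
                ballMeasure d {x | 0 < u (τ (σ (ρ n))) x}) atTop :=
              (ENNReal.liminf_const_mul_of_ne_top (by simp)).symm
          _ = m - a := hdiff.liminf_eq
    _ = m := add_tsub_cancel_of_le ham
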